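/- Let $k=\mathbf F_q$ be a finite field and let $X$ be a variety over $k$, i.e. a reduced and separated scheme of finite type over $k$. For a $k$-scheme $S$ put $N(S)=|S(k)|$, and for $n\ge 1$ put $N_n=|X(\mathbf F_{q^n})|$. For $n\ge 0$ let $X^n$ be the $n$-fold fibre product of $X$ over $k$, with the symmetric group $\mathfrak S_n$ permuting the factors. A symmetric product $X^{(n)}$ is a quotient of $X^n$ by $\mathfrak S_n$ in the category of $k$-schemes, i.e. a $k$-scheme $X^{(n)}$ with an $\mathfrak S_n$-invariant affine $k$-morphism $\pi_n\colon X^n\to X^{(n)}$ such that $\mathcal O_{X^{(n)}}\to(\pi_{n*}\mathcal O_{X^n})^{\mathfrak S_n}$ is an isomorphism; it is unique up to unique isomorphism if it exists. (a) If every finite set of points of $X$ is contained in an affine open subset (for example, if $X$ is quasi-projective), then $X^{(n)}$ exists for every $n\ge 0$. (b) The numbers $N_n$ ($n\ge1$) are finite. Whenever the symmetric products $X^{(n)}$ exist for all $n\ge0$, the numbers $N(X^{(n)})$ are finite, and the series $\sum_{n\ge 0} N(X^{(n)})\,T^n$ equals the Hasse–Weil zeta function of $X$: $$\sum_{n\ge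 0} N(X^{(n)})\,T^n=\exp\Bigl(\sum_{n\ge 1}\frac{N_n}{n}\,T^n\Bigr)\quad\text{in } \mathbf Q[[T]].$$ -/

import Mathlib

open CategoryTheory CategoryTheory.Limits AlgebraicGeometry

universe u

namespace SymZeta

/-- A variety over the base scheme `S`: a reduced and separated scheme of finite type over `S`. -/
structure IsVariety {S : Scheme.{u}} (X : Over S) : Prop where
  reduced : IsReduced X.left
  separated : IsSeparated X.hom
  locallyOfFiniteType : LocallyOfFiniteType X.hom
  quasiCompact : QuasiCompact X.hom

/-- Every finite set of points of `X` lies in an affine open subscheme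
(this holds for instance if `X` is quasi-projective over a field). -/
def FiniteSetsInAffine (X : Scheme.{u}) : Prop :=
  ∀ s : Set X, s.Finite → ∃ U : X.Opens, IsAffineOpen U ∧ s ⊆ U

/-- The quotient of a scheme `P` by a finite group, given by the automorphisms `act g`
(all in the category of `S`-schemes): an invariant affine morphism `π : P ⟶ Y` such that
`𝒪_Y ⟶ π_* 𝒪_P` is injective with image the invariant sections. These conditions
determine `π` up to unique isomorphism. -/
structure IsQuotient {S : Scheme.{u}} {G : Type*} {P Y : Over S}
    (act : G → (P ⟶ P)) (π : P ⟶ Y) : Prop where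
  invariant : ∀ g, act g ≫ π = π
  affine : IsAffineHom π.left
  injective : ∀ U : Y.left.Opens, Function.Injective (π.left.app U)
  exists_of_invariant : ∀ (U : Y.left.Opens) (s : Γ(P.left, π.left ⁻¹ᵁ U)),
    (∀ (g : G) (h : π.left ⁻¹ᵁ U ≤ (act g).left ⁻¹ᵁ (π.left ⁻¹ᵁ U)),
      (act g).left.appLE (π.left ⁻¹ᵁ U) (π.left ⁻¹ᵁ U) h s = s) →
    ∃ t : Γ(Y.left, U), π.left.app U t = s

noncomputable section

/-- The `n`-fold cartesian product `X ×_S ⋯ ×_S X`. -/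
abbrev power {S : Scheme.{u}} (X : Over S) (n : ℕ) : Over S := ∏ᶜ fun _ : Fin n => X

/-- The permutation `σ` of the factors of the `n`-fold cartesian product. -/
def permute {S : Scheme.{u}} (X : Over S) (n : ℕ) (σ : Equiv.Perm (Fin n)) :
    power X n ⟶ power X n :=
  Pi.lift fun i => Pi.π (fun _ : Fin n => X) (σ i)

/-- `π : X ^ n ⟶ Y` exhibits `Y` as the `n`-fold symmetric product of `X`: the quotient of
the cartesian product by the symmetric group. -/
def IsSymmetricProduct {S : Scheme.{u}} (X : Over S) (n : ℕ) {Y : Over S}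
    (π : power X n ⟶ Y) : Prop :=
  IsQuotient (permute X n) π

/-- The set `X(K)` of `K`-rational points of a `k`-scheme `X`: the `k`-morphisms
`Spec K ⟶ X`. -/
abbrev Points {k : Type u} [Field k] (X : Over (Spec (CommRingCat.of k)))
    (K : Type u) [Field K] [Algebra k K] : Type u :=
  Over.mk (Spec.map (CommRingCat.ofHom (algebraMap k K))) ⟶ X

open Polynomial in
/-- For a finite field `k` with `q` elements and `n ≥ 1`, the field with `q ^ n` elements, as
an extension of `k`. -/
abbrev Ext (k : Type u) [Field k] (n : ℕ) : Type u :=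
  (X ^ (Nat.card k ^ n) - X : k[X]).SplittingField

/-- The Hasse-Weil zeta function `exp (∑_{n ≥ 1} |X(𝔽_{q^n})| T^n / n)` of a scheme over the
finite field `k` with `q` elements. -/
def hasseWeil {k : Type u} [Field k] (X : Over (Spec (CommRingCat.of k))) : PowerSeries ℚ :=
  (PowerSeries.exp ℚ).subst
    (PowerSeries.mk fun n : ℕ =>
      if n = 0 then (0 : ℚ) else (Nat.card (Points X (Ext k n)) : ℚ) / n)

end

end SymZeta

/-!
**Existence.** If every finite set of points lies in an affine open subset, then every point of
`X ^ n` lies in some `U ^ n` with `U ⊆ X` affine open, and `U ^ n` is affine and stable under the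
symmetric group `G`. The quotient of a scheme `P` by `G` is the union of the `Spec Γ(P, W)ᴳ` over
all stable affine open subsets `W`: the maps between them are open immersions because the fibres of
`Spec A ⟶ Spec Aᴳ` are the orbits of `G`, and because `G`-invariants commute with inverting an
invariant element.

**Zeta function.** The points of `X^(n)` over an algebraic closure of `k` are the multisets of `n`
points of `X`, and those over `k` are the multisets invariant under Frobenius, an injective
map `F` whose `j`-th iterate fixes exactly the `N_j` points over the extension of degree `j`.
Counting in two ways the occurrences of points in the invariant multisets of cardinality `n` gives
`n a_n = ∑_{1 ≤ j ≤ n} N_j a_{n - j}` for the number `a_n` of these multisets. For the generating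
series `f` of `a` and `g = ∑ N_j T ^ j / j` this is the equation `f' = f g'`, so `f = exp g`.
-/

namespace SymZeta

section ExponentialSeries

open PowerSeries

variable {R : Type*} [CommRing R] [Algebra ℚ R]

lemma constantCoeff_exp_subst {g : PowerSeries R} (hg : constantCoeff g = 0) :
    constantCoeff ((exp R).subst g) = 1 := by
  have hsub : exp R = 1 + (exp R - 1) := by ring
  have hzero : constantCoeff ((exp R - 1).subst g) = 0 :=
    constantCoeff_subst_eq_zero hg _ (by simp)
  rw [hsub, ← coe_substAlgHom (HasSubst.of_constantCoeff_zero' hg), map_add, map_one,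
    coe_substAlgHom, map_add, map_one, hzero, add_zero]

lemma derivative_exp_subst {g : PowerSeries R} (hg : constantCoeff g = 0) :
    derivative R ((exp R).subst g) = (exp R).subst g * derivative R g := by
  rw [derivative_subst (HasSubst.of_constantCoeff_zero' hg), derivative_exp]

lemma mul_exp_subst_neg_eq_one {f g : PowerSeries R}
    (hg : constantCoeff g = 0) (hf : constantCoeff f = 1)
    (hfg : derivative R f = f * derivative R g) : f * (exp R).subst (-g) = 1 := by
  have : IsAddTorsionFree R := .of_module_rat R
  have hg' : constantCoeff (-g) = 0 := by rw [map_neg, hg, neg_zero]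
  refine derivative.ext ?_ (by rw [map_mul, hf, constantCoeff_exp_subst hg', one_mul, map_one])
  rw [Derivation.leibniz, derivative_exp_subst hg', hfg, map_neg, derivative_one]
  simp only [smul_eq_mul]
  ring

lemma eq_exp_subst {f g : PowerSeries R} (hg : constantCoeff g = 0)
    (hf : constantCoeff f = 1) (hfg : derivative R f = f * derivative R g) :
    f = (exp R).subst g :=
  calc f = f * ((exp R).subst g * (exp R).subst (-g)) := by
        rw [mul_exp_subst_neg_eq_one hg (constantCoeff_exp_subst hg) (derivative_exp_subst hg),
          mul_one]
    _ = (exp R).subst g * (f * (exp R).subst (-g)) := by ring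
    _ = (exp R).subst g := by rw [mul_exp_subst_neg_eq_one hg hf hfg, mul_one]

lemma mk_eq_exp_subst_of_recurrence {a N : ℕ → ℕ} (h0 : a 0 = 1)
    (hrec : ∀ n, n * a n = ∑ j ∈ Finset.Icc 1 n, N j * a (n - j)) :
    mk (fun n => (a n : ℚ)) =
      (exp ℚ).subst (mk fun n : ℕ => if n = 0 then (0 : ℚ) else (N n : ℚ) / n) := by
  refine eq_exp_subst (by simp) (by simp [h0]) ?_
  ext n
  have hshift : Finset.Icc 1 (n + 1) = (Finset.range (n + 1)).map (addRightEmbedding 1) := by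
    rw [Finset.range_eq_Ico, Finset.map_add_right_Ico, zero_add]
    rfl
  have hcast : ((n : ℚ) + 1) * a (n + 1) =
      ∑ i ∈ Finset.range (n + 1), (N (i + 1) : ℚ) * a (n - i) := by
    have := hrec (n + 1)
    rw [hshift, Finset.sum_map] at this
    simpa using congrArg (Nat.cast : ℕ → ℚ) this
  rw [coeff_derivative, coeff_mk, mul_comm, hcast, mul_comm (mk _), coeff_mul,
    Finset.Nat.sum_antidiagonal_eq_sum_range_succ_mk]
  refine Finset.sum_congr rfl fun i _ => ?_
  have hi : (i : ℚ) + 1 ≠ 0 := i.cast_add_one_ne_zero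
  rw [coeff_derivative, coeff_mk, coeff_mk, if_neg i.succ_ne_zero]
  push_cast
  rw [div_mul_cancel₀ _ hi]

end ExponentialSeries

section InvariantMultisets

open Function

variable {α : Type*} {F : α → α}

variable (F) in
/-- The multisets of `n` elements that are invariant under `F`. -/
def invariantMultisets (n : ℕ) : Set (Multiset α) := {m | m.card = n ∧ m.map F = m}

variable (F) in
/-- The orbit of a periodic point, each of its elements being taken once; it is empty at a point
that is not periodic. -/
noncomputable def orbitMultiset (z : α) : Multiset α := (periodicOrbit F z).toMultiset

lemma orbitMultiset_eq_map_range (z : α) :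
    orbitMultiset F z = (Multiset.range (minimalPeriod F z)).map fun i => F^[i] z :=
  rfl

lemma card_orbitMultiset (z : α) : (orbitMultiset F z).card = minimalPeriod F z := by
  rw [orbitMultiset, Cycle.card_toMultiset, periodicOrbit_length]

lemma nodup_orbitMultiset (z : α) : (orbitMultiset F z).Nodup :=
  Multiset.coe_nodup.2 (Cycle.nodup_coe_iff.1 nodup_periodicOrbit)

lemma mem_orbitMultiset {z w : α} (hz : z ∈ periodicPts F) :
    w ∈ orbitMultiset F z ↔ ∃ i, F^[i] z = w :=
  mem_periodicOrbit_iff hz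

lemma map_orbitMultiset {z : α} (hz : z ∈ periodicPts F) :
    (orbitMultiset F z).map F = orbitMultiset F z := by
  calc (orbitMultiset F z).map F = orbitMultiset F (F z) := by
        simp only [orbitMultiset_eq_map_range, Multiset.map_map, minimalPeriod_apply hz,
          comp_apply, ← iterate_succ_apply, ← iterate_succ_apply']
    _ = orbitMultiset F z := by rw [orbitMultiset, orbitMultiset, periodicOrbit_apply_eq hz]

lemma iterate_mem_of_map_eq {m : Multiset α} (hm : m.map F = m) {z : α} (hz : z ∈ m) (i : ℕ) :
    F^[i] z ∈ m := by
  induction i with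
  | zero => exact hz
  | succ i ih =>
    rw [iterate_succ_apply', ← hm]
    exact Multiset.mem_map_of_mem F ih

lemma count_iterate_of_map_eq [DecidableEq α] (hF : Injective F) {m : Multiset α}
    (hm : m.map F = m) (z : α) (i : ℕ) : m.count (F^[i] z) = m.count z := by
  induction i with
  | zero => rfl
  | succ i ih =>
    calc m.count (F^[i + 1] z) = (m.map F).count (F (F^[i] z)) := by
          rw [iterate_succ_apply', hm]
      _ = m.count z := by rw [Multiset.count_map_eq_count' F m hF, ih]

lemma mem_periodicPts_of_map_eq (hF : Injective F) {m : Multiset α} (hm : m.map F = m)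
    {z : α} (hz : z ∈ m) : z ∈ periodicPts F := by
  classical
  obtain ⟨i, j, hne, hij⟩ := Finite.exists_ne_map_eq_of_infinite fun i : ℕ =>
    (⟨F^[i] z, Multiset.mem_toFinset.2 (iterate_mem_of_map_eq hm hz i)⟩ : m.toFinset)
  wlog hlt : i < j generalizing i j
  · exact this j i hne.symm hij.symm (by omega)
  exact mk_mem_periodicPts (Nat.sub_pos_of_lt hlt)
    (iterate_cancel hF (congrArg Subtype.val hij).symm)

lemma minimalPeriod_le_card (hF : Injective F) {m : Multiset α} (hm : m.map F = m)
    {z : α} (hz : z ∈ m) : minimalPeriod F z ≤ m.card := by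
  rw [← card_orbitMultiset]
  refine Multiset.card_le_card (Multiset.le_iff_subset (nodup_orbitMultiset z) |>.2 fun w hw => ?_)
  obtain ⟨i, rfl⟩ := (mem_orbitMultiset (mem_periodicPts_of_map_eq hF hm hz)).1 hw
  exact iterate_mem_of_map_eq hm hz i

lemma le_count_iff_nsmul_orbitMultiset_le [DecidableEq α] (hF : Injective F) {m : Multiset α}
    (hm : m.map F = m) {z : α} (hz : z ∈ periodicPts F) {i : ℕ} :
    i ≤ m.count z ↔ i • orbitMultiset F z ≤ m := by
  simp only [Multiset.le_iff_count, Multiset.count_nsmul]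
  have hself : z ∈ orbitMultiset F z := (mem_orbitMultiset hz).2 ⟨0, rfl⟩
  refine ⟨fun hi w => ?_, fun h => ?_⟩
  · by_cases hw : w ∈ orbitMultiset F z
    · obtain ⟨j, rfl⟩ := (mem_orbitMultiset hz).1 hw
      rwa [Multiset.count_eq_one_of_mem (nodup_orbitMultiset z) hw, mul_one,
        count_iterate_of_map_eq hF hm]
    · simp [Multiset.count_eq_zero_of_notMem hw]
  · simpa [Multiset.count_eq_one_of_mem (nodup_orbitMultiset z) hself] using h z

lemma add_nsmul_orbitMultiset_mem_invariantMultisets_iff {z : α} (hz : z ∈ periodicPts F)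
    {m : Multiset α} {i n : ℕ} :
    m + i • orbitMultiset F z ∈ invariantMultisets F (n + i * minimalPeriod F z) ↔
      m ∈ invariantMultisets F n := by
  simp [invariantMultisets, map_orbitMultiset hz, card_orbitMultiset, Multiset.map_nsmul]

lemma ncard_setOf_nsmul_orbitMultiset_le {z : α} (hz : z ∈ periodicPts F) (i n : ℕ) :
    {m ∈ invariantMultisets F (n + i * minimalPeriod F z) | i • orbitMultiset F z ≤ m}.ncard =
      (invariantMultisets F n).ncard := by
  have himage : {m ∈ invariantMultisets F (n + i * minimalPeriod F z) | i • orbitMultiset F z ≤ m} =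
      (· + i • orbitMultiset F z) '' invariantMultisets F n := by
    ext m
    constructor
    · rintro ⟨hm, hle⟩
      obtain ⟨m', rfl⟩ := Multiset.le_iff_exists_add.1 hle
      rw [add_comm (i • orbitMultiset F z)] at hm ⊢
      exact ⟨m', (add_nsmul_orbitMultiset_mem_invariantMultisets_iff hz).1 hm, rfl⟩
    · rintro ⟨m', hm', rfl⟩
      exact ⟨(add_nsmul_orbitMultiset_mem_invariantMultisets_iff hz).2 hm', le_add_self⟩
  rw [himage, Set.ncard_image_of_injective _ (add_left_injective _)]

lemma exists_mem_ptsOfPeriod (hF : Injective F) {m : Multiset α} (hm : m.map F = m) {z : α}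
    (hz : z ∈ m) : ∃ j, (1 ≤ j ∧ j ≤ m.card) ∧ z ∈ ptsOfPeriod F j :=
  ⟨minimalPeriod F z,
    ⟨minimalPeriod_pos_of_mem_periodicPts (mem_periodicPts_of_map_eq hF hm hz),
      minimalPeriod_le_card hF hm hz⟩, isPeriodicPt_minimalPeriod F z⟩

lemma finite_biUnion_ptsOfPeriod (hfix : ∀ j, 1 ≤ j → (ptsOfPeriod F j).Finite) (n : ℕ) :
    (⋃ j ∈ Finset.Icc 1 n, ptsOfPeriod F j).Finite :=
  Set.Finite.biUnion (Finset.finite_toSet _) fun j hj => hfix j (Finset.mem_Icc.1 hj).1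

lemma invariantMultisets_finite (hF : Injective F)
    (hfix : ∀ j, 1 ≤ j → (ptsOfPeriod F j).Finite) (n : ℕ) : (invariantMultisets F n).Finite := by
  classical
  have hfin := finite_biUnion_ptsOfPeriod hfix n
  refine (Set.finite_Iic (n • hfin.toFinset.val)).subset ?_
  rintro m ⟨rfl, hm⟩
  refine Multiset.le_iff_count.2 fun z => ?_
  by_cases hz : z ∈ m
  · have hz' : z ∈ hfin.toFinset := by
      simpa using exists_mem_ptsOfPeriod hF hm hz
    rw [Multiset.count_nsmul, Multiset.count_eq_one_of_mem hfin.toFinset.nodup hz', mul_one]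
    exact Multiset.count_le_card z m
  · simp [Multiset.count_eq_zero_of_notMem hz]

lemma count_mul_minimalPeriod_le_card [DecidableEq α] (hF : Injective F) {m : Multiset α}
    (hm : m.map F = m) {z : α} (hz : z ∈ periodicPts F) :
    m.count z * minimalPeriod F z ≤ m.card := by
  have hle := Multiset.card_le_card ((le_count_iff_nsmul_orbitMultiset_le hF hm hz).1 le_rfl)
  rwa [Multiset.card_nsmul, card_orbitMultiset] at hle

lemma card_filter_le_count_invariantMultisets [DecidableEq α] (hF : Injective F) {z : α}
    (hz : z ∈ periodicPts F) {n i : ℕ} {I : Finset (Multiset α)}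
    (hI : ∀ m, m ∈ I ↔ m ∈ invariantMultisets F n) (hi : i * minimalPeriod F z ≤ n) :
    {m ∈ I | i ≤ m.count z}.card =
      (invariantMultisets F (n - i * minimalPeriod F z)).ncard := by
  rw [← ncard_setOf_nsmul_orbitMultiset_le hz i, Nat.sub_add_cancel hi, ← Set.ncard_coe_finset]
  congr 1
  ext m
  simp only [Finset.coe_filter, Set.mem_ofPred_eq, hI]
  exact and_congr_right fun hm => le_count_iff_nsmul_orbitMultiset_le hF hm.2 hz

lemma sum_Icc_div_mul {M : Type*} [AddCommMonoid M] {d : ℕ} (hd : 0 < d) (n : ℕ) (f : ℕ → M) :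
    ∑ i ∈ Finset.Icc 1 (n / d), f (i * d) = ∑ j ∈ Finset.Icc 1 n with d ∣ j, f j := by
  refine Finset.sum_nbij' (· * d) (· / d) ?_ ?_ (fun i _ => Nat.mul_div_cancel i hd)
    (fun j hj => Nat.div_mul_cancel (Finset.mem_filter.1 hj).2) fun _ _ => rfl
  · intro i hi
    rw [Finset.mem_Icc, Nat.le_div_iff_mul_le hd] at hi
    exact Finset.mem_filter.2 ⟨Finset.mem_Icc.2 ⟨Nat.mul_pos hi.1 hd, hi.2⟩, Nat.dvd_mul_left _ i⟩
  · intro j hj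
    rw [Finset.mem_filter, Finset.mem_Icc] at hj
    exact Finset.mem_Icc.2
      ⟨Nat.div_pos (Nat.le_of_dvd hj.1.1 hj.2) hd, Nat.div_le_div_right hj.1.2⟩

lemma sum_count_invariantMultisets [DecidableEq α] (hF : Injective F) {z : α}
    (hz : z ∈ periodicPts F) {n : ℕ} {I : Finset (Multiset α)}
    (hI : ∀ m, m ∈ I ↔ m ∈ invariantMultisets F n) :
    ∑ m ∈ I, m.count z =
      ∑ j ∈ Finset.Icc 1 n with minimalPeriod F z ∣ j, (invariantMultisets F (n - j)).ncard := by
  have hd : 0 < minimalPeriod F z := minimalPeriod_pos_of_mem_periodicPts hz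
  calc ∑ m ∈ I, m.count z
      = ∑ m ∈ I, {i ∈ Finset.Icc 1 (n / minimalPeriod F z) | i ≤ m.count z}.card := by
        refine Finset.sum_congr rfl fun m hm => ?_
        obtain ⟨hcard, hinv⟩ := (hI m).1 hm
        have hcount : m.count z ≤ n / minimalPeriod F z := by
          rw [Nat.le_div_iff_mul_le hd, ← hcard]
          exact count_mul_minimalPeriod_le_card hF hinv hz
        have hfilter : (Finset.Icc 1 (n / minimalPeriod F z)).filter (· ≤ m.count z) =
            Finset.Icc 1 (m.count z) := by
          ext i
          simp only [Finset.mem_filter, Finset.mem_Icc]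
          omega
        rw [hfilter, Nat.card_Icc, Nat.add_sub_cancel]
    _ = ∑ i ∈ Finset.Icc 1 (n / minimalPeriod F z), {m ∈ I | i ≤ m.count z}.card :=
        Finset.sum_card_bipartiteAbove_eq_sum_card_bipartiteBelow _
    _ = ∑ i ∈ Finset.Icc 1 (n / minimalPeriod F z),
          (invariantMultisets F (n - i * minimalPeriod F z)).ncard :=
        Finset.sum_congr rfl fun i hi => card_filter_le_count_invariantMultisets hF hz hI
          ((Nat.le_div_iff_mul_le hd).1 (Finset.mem_Icc.1 hi).2)
    _ = ∑ j ∈ Finset.Icc 1 n with minimalPeriod F z ∣ j, (invariantMultisets F (n - j)).ncard :=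
        sum_Icc_div_mul hd n fun j => (invariantMultisets F (n - j)).ncard

/-- Counts the occurrences of all points in all invariant multisets of cardinality `n`: each
multiset contributes `n`, and a point of minimal period `d` occurs at least `i` times in as many of
them as there are invariant multisets of cardinality `n - i * d`. -/
lemma mul_ncard_invariantMultisets (hF : Injective F)
    (hfix : ∀ j, 1 ≤ j → (ptsOfPeriod F j).Finite) (n : ℕ) :
    n * (invariantMultisets F n).ncard =
      ∑ j ∈ Finset.Icc 1 n, (ptsOfPeriod F j).ncard * (invariantMultisets F (n - j)).ncard := by
  classical
  obtain ⟨I, hI⟩ := (invariantMultisets_finite hF hfix n).exists_finset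
  obtain ⟨P, hP⟩ := (finite_biUnion_ptsOfPeriod hfix n).exists_finset
  simp only [Set.mem_iUnion, Finset.mem_Icc, exists_prop] at hP
  calc n * (invariantMultisets F n).ncard = ∑ _m ∈ I, n := by
        rw [Finset.sum_const, smul_eq_mul, mul_comm, ← Set.ncard_coe_finset I]
        congr 2
        exact Set.ext fun m => (hI m).symm
    _ = ∑ m ∈ I, ∑ z ∈ P, m.count z := by
        refine Finset.sum_congr rfl fun m hm => ?_
        obtain ⟨hcard, hinv⟩ := (hI m).1 hm
        rw [Multiset.sum_count_eq_card fun z hz => (hP z).2 ?_, hcard]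
        exact hcard ▸ exists_mem_ptsOfPeriod hF hinv hz
    _ = ∑ z ∈ P, ∑ j ∈ Finset.Icc 1 n with minimalPeriod F z ∣ j,
          (invariantMultisets F (n - j)).ncard := by
        rw [Finset.sum_comm]
        refine Finset.sum_congr rfl fun z hz => sum_count_invariantMultisets hF ?_ hI
        obtain ⟨j, hj, hzj⟩ := (hP z).1 hz
        exact mk_mem_periodicPts hj.1 hzj
    _ = ∑ j ∈ Finset.Icc 1 n, ∑ z ∈ P with minimalPeriod F z ∣ j,
          (invariantMultisets F (n - j)).ncard := by
        simp only [Finset.sum_filter]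
        exact Finset.sum_comm
    _ = ∑ j ∈ Finset.Icc 1 n, (ptsOfPeriod F j).ncard * (invariantMultisets F (n - j)).ncard := by
        refine Finset.sum_congr rfl fun j hj => ?_
        rw [Finset.sum_const, smul_eq_mul, ← Set.ncard_coe_finset]
        congr 2
        ext z
        rw [Finset.mem_coe, Finset.mem_filter, ← isPeriodicPt_iff_minimalPeriod_dvd, hP]
        exact and_iff_right_of_imp fun hz => ⟨j, Finset.mem_Icc.1 hj, hz⟩

lemma ncard_invariantMultisets_zero : (invariantMultisets F 0).ncard = 1 := by
  rw [Set.ncard_eq_one]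
  refine ⟨0, Set.eq_singleton_iff_unique_mem.2 ⟨?_, fun m hm => Multiset.card_eq_zero.1 hm.1⟩⟩
  exact ⟨Multiset.card_zero, Multiset.map_zero F⟩

end InvariantMultisets

section RingOfInvariants

variable {G : Type*} [Group G] {A B : Type*} [CommRing A] [CommRing B]

/-- The homomorphism `i : B →+* A` identifies `B` with the ring of invariants of the action `σ` of
`G` on `A`. Unlike `Algebra.IsInvariant` this is a predicate on homomorphisms, as it is applied to
rings of sections, which carry neither an algebra structure nor an action as instances. -/
structure IsRingOfInvariants (σ : G →* (A →+* A)) (i : B →+* A) : Prop where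
  injective : Function.Injective i
  map_apply : ∀ g b, σ g (i b) = i b
  exists_eq : ∀ a, (∀ g, σ g a = a) → ∃ b, i b = a

variable {σ : G →* (A →+* A)} {i : B →+* A}

lemma IsRingOfInvariants.isIntegral [Finite G] (h : IsRingOfInvariants σ i) : i.IsIntegral := by
  let := i.toAlgebra
  let : MulSemiringAction G A := MulSemiringAction.compHom A σ
  have : Algebra.IsInvariant B A G := ⟨fun a ha => h.exists_eq a ha⟩
  exact (Algebra.IsInvariant.isIntegral B A G).isIntegral

lemma IsRingOfInvariants.comap_surjective [Finite G] (h : IsRingOfInvariants σ i) :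
    Function.Surjective (PrimeSpectrum.comap i) :=
  h.isIntegral.comap_surjective h.injective

lemma IsRingOfInvariants.exists_eq_comap [Finite G] (h : IsRingOfInvariants σ i)
    {p q : PrimeSpectrum A} (hpq : PrimeSpectrum.comap i p = PrimeSpectrum.comap i q) :
    ∃ g, q = PrimeSpectrum.comap (σ g) p := by
  let := i.toAlgebra
  let : MulSemiringAction G A := MulSemiringAction.compHom A σ
  have : Algebra.IsInvariant B A G := ⟨fun a ha => h.exists_eq a ha⟩
  have : SMulCommClass G B A := ⟨fun g b a => by
    change σ g (i b * a) = i b * σ g a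
    rw [map_mul, h.map_apply]⟩
  obtain ⟨g, hg⟩ := Algebra.IsInvariant.exists_smul_of_under_eq B A G p.asIdeal q.asIdeal
    (congrArg PrimeSpectrum.asIdeal hpq)
  refine ⟨g⁻¹, ?_⟩
  ext a
  rw [hg, Ideal.mem_pointwise_smul_iff_inv_smul_mem]
  rfl

section Conjugacy

open Polynomial

variable {K : Type*} [CommRing K] {φ ψ : A →+* K}

lemma map_charpoly_eq [Fintype G] [MulSemiringAction G A]
    (h : ∀ a : A, (∀ g : G, g • a = a) → φ a = ψ a) (p : A[X]) :
    (MulSemiringAction.charpoly G p).map (mapRingHom φ) =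
      (MulSemiringAction.charpoly G p).map (mapRingHom ψ) := by
  ext n m
  simp only [coeff_map, coe_mapRingHom]
  refine h _ fun g => ?_
  rw [← coeff_smul, MulSemiringAction.smul_coeff_charpoly]

lemma exists_map_eq_map_smul [Finite G] [MulSemiringAction G A] [IsDomain K]
    (h : ∀ a : A, (∀ g : G, g • a = a) → φ a = ψ a) (p : A[X]) :
    ∃ g : G, p.map ψ = (g • p).map φ := by
  cases nonempty_fintype G
  have hroot : ((MulSemiringAction.charpoly G p).map (mapRingHom φ)).eval (mapRingHom ψ p) = 0 := by
    rw [map_charpoly_eq h, Polynomial.eval_map, eval₂_hom,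
      MulSemiringAction.eval_charpoly, map_zero]
  rw [MulSemiringAction.charpoly_eq, Polynomial.map_prod, eval_prod,
    Finset.prod_eq_zero_iff] at hroot
  obtain ⟨g, -, hg⟩ := hroot
  exact ⟨g, by simpa [sub_eq_zero] using hg⟩

/-- If no `g` worked, there would be `a g` with `ψ (a g) ≠ φ (g • a g)` for each `g`. These finitely
many elements are the coefficients of a single polynomial over `A`, whose image under `ψ` is the
image under `φ` of one of its conjugates. -/
lemma exists_forall_eq_apply_smul [Finite G] [MulSemiringAction G A] [IsDomain K]
    (h : ∀ a : A, (∀ g : G, g • a = a) → φ a = ψ a) : ∃ g : G, ∀ a, ψ a = φ (g • a) := by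
  classical
  by_contra! hne
  choose a ha using hne
  let e := Finite.equivFin G
  let p : A[X] := Polynomial.ofFn (Nat.card G) (a ∘ e.symm)
  have hp : ∀ g, p.coeff (e g) = a g := fun g => by
    rw [Polynomial.ofFn_coeff_eq_val_of_lt _ (e g).isLt, Function.comp_apply, Fin.eta,
      e.symm_apply_apply]
  obtain ⟨g, hg⟩ := exists_map_eq_map_smul h p
  refine ha g ?_
  rw [← hp g, ← coeff_map, hg, coeff_map, coeff_smul]

lemma IsRingOfInvariants.exists_eq_comp [Finite G] [IsDomain K] (h : IsRingOfInvariants σ i)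
    (hφψ : φ.comp i = ψ.comp i) : ∃ g, ψ = φ.comp (σ g) := by
  let : MulSemiringAction G A := MulSemiringAction.compHom A σ
  obtain ⟨g, hg⟩ := exists_forall_eq_apply_smul (G := G) (φ := φ) (ψ := ψ) fun a ha => by
    obtain ⟨b, rfl⟩ := h.exists_eq a ha
    exact RingHom.congr_fun hφψ b
  exact ⟨g, RingHom.ext hg⟩

end Conjugacy

lemma exists_comp_eq_of_isIntegral (hi : i.IsIntegral) (hinj : Function.Injective i)
    {K : Type*} [Field K] [IsAlgClosed K] (β : B →+* K) : ∃ φ : A →+* K, φ.comp i = β := by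
  let := i.toAlgebra
  have : Algebra.IsIntegral B A := ⟨hi⟩
  have : (RingHom.ker β).IsPrime := RingHom.ker_isPrime β
  obtain ⟨Q, -, hQ, hQB⟩ := Ideal.exists_ideal_over_prime_of_isIntegral (RingHom.ker β)
    (⊥ : Ideal A) (le_of_eq_of_le ((RingHom.injective_iff_ker_eq_bot i).1 hinj) bot_le)
  have : Q.LiesOver (RingHom.ker β) := ⟨hQB.symm⟩
  let : Algebra (B ⧸ RingHom.ker β) K := (RingHom.kerLift β).toAlgebra
  have : Module.IsTorsionFree (B ⧸ RingHom.ker β) K :=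
    Module.isTorsionFree_iff_algebraMap_injective.2 (RingHom.kerLift_injective β)
  have : Module.IsTorsionFree (B ⧸ RingHom.ker β) (A ⧸ Q) :=
    Module.isTorsionFree_iff_algebraMap_injective.2 (FaithfulSMul.algebraMap_injective _ _)
  let φ : (A ⧸ Q) →ₐ[B ⧸ RingHom.ker β] K := IsAlgClosed.lift
  exact ⟨φ.toRingHom.comp (Ideal.Quotient.mk Q),
    RingHom.ext fun b => φ.commutes (Ideal.Quotient.mk _ b)⟩

section Localization

variable {A' B' : Type*} [CommRing A'] [CommRing B'] {i' : B' →+* A'} {r : A →+* A'} {s : B →+* B'}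
  {f : B}

lemma exists_pow_mul_eq_zero_of_comp_eq (hi : Function.Injective i) (hrs : r.comp i = i'.comp s)
    (hker : ∀ a, r a = 0 → ∃ n : ℕ, i f ^ n * a = 0) {b : B} (hb : s b = 0) :
    ∃ n : ℕ, f ^ n * b = 0 := by
  have hr : r (i b) = 0 := (RingHom.congr_fun hrs b).trans (by simp [hb])
  obtain ⟨n, hn⟩ := hker (i b) hr
  exact ⟨n, hi (by rw [map_mul, map_pow, hn, map_zero])⟩

lemma IsRingOfInvariants.exists_pow_mul_eq_of_forall [Finite G] (h : IsRingOfInvariants σ i)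
    {a : A} (ha : ∀ g, ∃ n : ℕ, i f ^ n * (σ g a - a) = 0) :
    ∃ (n : ℕ) (b : B), i b = i f ^ n * a := by
  classical
  cases nonempty_fintype G
  choose N hN using ha
  refine ⟨∑ g, N g, h.exists_eq _ fun g => ?_⟩
  rw [map_mul, map_pow, h.map_apply, ← sub_eq_zero, ← mul_sub,
    ← Finset.sum_erase_add _ _ (Finset.mem_univ g), pow_add, mul_assoc, hN, mul_zero]

lemma IsRingOfInvariants.exists_map_eq_pow_mul [Finite G] (h : IsRingOfInvariants σ i)
    {σ' : G →* (A' →+* A')} (h' : IsRingOfInvariants σ' i') (hrs : r.comp i = i'.comp s)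
    (hr : ∀ g, r.comp (σ g) = (σ' g).comp r) (hker : ∀ a, r a = 0 → ∃ n : ℕ, i f ^ n * a = 0)
    (hsurj : ∀ a', ∃ (n : ℕ) (a : A), r a = r (i f) ^ n * a') (b' : B') :
    ∃ (n : ℕ) (b : B), s b = s f ^ n * b' := by
  have hri (b : B) : r (i b) = i' (s b) := RingHom.congr_fun hrs b
  obtain ⟨n, a, ha⟩ := hsurj (i' b')
  have hinv (g : G) : r (σ g a) = r a := by
    rw [← RingHom.comp_apply, hr, RingHom.comp_apply, ha, map_mul, map_pow, hri, h'.map_apply,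
      h'.map_apply]
  obtain ⟨m, b, hb⟩ := h.exists_pow_mul_eq_of_forall (f := f) (a := a) fun g =>
    hker _ (by rw [map_sub, hinv, sub_self])
  refine ⟨m + n, b, h'.injective ?_⟩
  rw [← hri, hb, map_mul, map_pow, ha, map_mul, map_pow, ← hri, ← mul_assoc, ← pow_add]

lemma isLocalizationAway_of_comp {L : Type*} [CommRing L] [Algebra B L] [Algebra B' L]
    [IsLocalization.Away (s f) L] (hL : algebraMap B L = (algebraMap B' L).comp s)
    (hker : ∀ b, s b = 0 → ∃ n : ℕ, f ^ n * b = 0)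
    (hsurj : ∀ b', ∃ (n : ℕ) (b : B), s b = s f ^ n * b') : IsLocalization.Away f L := by
  have hunit : IsUnit (algebraMap B L f) := by
    rw [hL]
    exact IsLocalization.Away.algebraMap_isUnit (s f)
  refine IsLocalization.Away.mk f hunit (fun z => ?_) fun b c hbc => ?_
  · obtain ⟨n, b', hb'⟩ := IsLocalization.Away.surj (s f) z
    obtain ⟨m, b, hb⟩ := hsurj b'
    refine ⟨n + m, b, ?_⟩
    rw [hL, RingHom.comp_apply, RingHom.comp_apply, pow_add, ← mul_assoc, hb', hb, map_mul,
      map_pow, mul_comm]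
  · rw [hL] at hbc
    obtain ⟨n, hn⟩ := IsLocalization.Away.exists_of_eq (s f) hbc
    obtain ⟨m, hm⟩ := hker (f ^ n * (b - c)) (by
      rw [map_mul, map_pow, map_sub, mul_sub, hn, sub_self])
    refine ⟨m + n, ?_⟩
    rw [← sub_eq_zero, ← mul_sub, pow_add, mul_assoc, hm]

end Localization

end RingOfInvariants

section Action

variable {P : Scheme.{u}} {G : Type*} [Group G]

/-- The endomorphisms `ρ g` of the scheme `P` constitute an action of `G`. As composition is written
in diagrammatic order, this is a right action, hence a left action on functions. -/
structure IsAction (ρ : G → (P ⟶ P)) : Prop where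
  map_one : ρ 1 = 𝟙 P
  map_mul : ∀ g h, ρ (g * h) = ρ g ≫ ρ h

variable {ρ : G → (P ⟶ P)}

/-- The action of `G` on the sections over an invariant open subset. -/
def sectionAction (hρ : IsAction ρ) (W : P.Opens) (hW : ∀ g, W ≤ ρ g ⁻¹ᵁ W) :
    G →* (Γ(P, W) →+* Γ(P, W)) where
  toFun g := ((ρ g).appLE W W (hW g)).hom
  map_one' := by
    simp only [hρ.map_one]
    rw [Scheme.Hom.appLE, Scheme.Hom.id_app]
    exact congrArg CommRingCat.Hom.hom ((Category.id_comp _).trans (P.presheaf.map_id _))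
  map_mul' g h := by
    simp only [hρ.map_mul]
    rw [← Scheme.Hom.appLE_comp_appLE _ _ _ W _ (hW h) (hW g)]
    rfl

lemma map_comp_sectionAction (hρ : IsAction ρ) {U V : P.Opens} (h : U ≤ V)
    (hU : ∀ g, U ≤ ρ g ⁻¹ᵁ U) (hV : ∀ g, V ≤ ρ g ⁻¹ᵁ V) (g : G) :
    (P.presheaf.map (homOfLE h).op).hom.comp (sectionAction hρ V hV g) =
      (sectionAction hρ U hU g).comp (P.presheaf.map (homOfLE h).op).hom := by
  have hcomp : (ρ g).appLE V V (hV g) ≫ P.presheaf.map (homOfLE h).op =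
      P.presheaf.map (homOfLE h).op ≫ (ρ g).appLE U U (hU g) := by
    rw [Scheme.Hom.appLE_map, Scheme.Hom.map_appLE]
  exact congrArg CommRingCat.Hom.hom hcomp

lemma sectionAction_appLE (hρ : IsAction ρ) {Y : Scheme.{u}} {π : P ⟶ Y}
    (hπ : ∀ g, ρ g ≫ π = π) {W : P.Opens} (hW : ∀ g, W ≤ ρ g ⁻¹ᵁ W) {V : Y.Opens}
    (h : W ≤ π ⁻¹ᵁ V) (g : G) (b : Γ(Y, V)) :
    sectionAction hρ W hW g (π.appLE V W h b) = π.appLE V W h b := by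
  have hcomp : π.appLE V W h ≫ (ρ g).appLE W W (hW g) = π.appLE V W h := by
    rw [Scheme.Hom.appLE_comp_appLE]
    simp only [hπ]
  exact congr($hcomp b)

lemma preimage_le_of_comp_eq {Y : Scheme.{u}} {f : P ⟶ P} {π : P ⟶ Y} (h : f ≫ π = π)
    (V : Y.Opens) : π ⁻¹ᵁ V ≤ f ⁻¹ᵁ (π ⁻¹ᵁ V) := by
  rw [← Scheme.Hom.comp_preimage, h]

end Action

section FieldValuedPoints

variable {P : Scheme.{u}}

lemma exists_eq_specMap_fromSpec {W : P.Opens} (hW : IsAffineOpen W) {R : CommRingCat.{u}}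
    (p : Spec R ⟶ P) (hp : ∀ x, p x ∈ W) : ∃ φ : Γ(P, W) ⟶ R, p = Spec.map φ ≫ hW.fromSpec := by
  have hrange : Set.range p ⊆ Set.range hW.fromSpec := by
    rw [hW.range_fromSpec]
    exact Set.range_subset_iff.2 hp
  refine ⟨Spec.preimage (IsOpenImmersion.lift hW.fromSpec p hrange), ?_⟩
  rw [Spec.map_preimage, IsOpenImmersion.lift_fac]

lemma specMap_fromSpec_injective {W : P.Opens} (hW : IsAffineOpen W) {R : CommRingCat.{u}}
    {φ ψ : Γ(P, W) ⟶ R} (h : Spec.map φ ≫ hW.fromSpec = Spec.map ψ ≫ hW.fromSpec) : φ = ψ :=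
  Spec.map_inj.1 ((cancel_mono _).1 h)

lemma exists_affineOpen_forall_mem {K : Type u} [Field K] (p : Spec (CommRingCat.of K) ⟶ P) :
    ∃ W : P.Opens, IsAffineOpen W ∧ ∀ x, p x ∈ W := by
  obtain ⟨W, hW, hx, -⟩ := exists_isAffineOpen_mem_and_subset (x := p default) (U := ⊤) trivial
  exact ⟨W, hW, fun x => Subsingleton.elim default x ▸ hx⟩

variable {K' K : Type u} [Field K'] [Field K]

instance epi_specMap_of_field (j : K' →+* K) : Epi (Spec.map (CommRingCat.ofHom j)) := by
  have : Flat (Spec.map (CommRingCat.ofHom j)) := by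
    let := j.toAlgebra
    rw [Flat.SpecMap_iff]
    exact Module.Flat.of_free (R := K') (M := K)
  have : Surjective (Spec.map (CommRingCat.ofHom j)) :=
    ⟨fun x => ⟨default, Subsingleton.elim _ _⟩⟩
  exact Flat.epi_of_flat_of_surjective _

lemma exists_specMap_comp_eq_of_forall_mem_range (j : K' →+* K) {F : K →+* K}
    (hF : ∀ x, F x = x → x ∈ j.range) {p : Spec (CommRingCat.of K) ⟶ P}
    (hp : Spec.map (CommRingCat.ofHom F) ≫ p = p) :
    ∃ q : Spec (CommRingCat.of K') ⟶ P, Spec.map (CommRingCat.ofHom j) ≫ q = p := by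
  obtain ⟨W, hW, hpW⟩ := exists_affineOpen_forall_mem p
  obtain ⟨φ, rfl⟩ := exists_eq_specMap_fromSpec hW p hpW
  rw [← Spec.map_comp_assoc] at hp
  have hφ (a : Γ(P, W)) : φ a ∈ j.range := hF _ (congr($(specMap_fromSpec_injective hW hp) a))
  let e : K' ≃+* j.range := RingEquiv.ofBijective j.rangeRestrict
    ⟨j.injective.codRestrict _, j.rangeRestrict_surjective⟩
  let ψ : Γ(P, W) →+* K' := e.symm.toRingHom.comp (φ.hom.codRestrict j.range hφ)
  refine ⟨Spec.map (CommRingCat.ofHom ψ) ≫ hW.fromSpec, ?_⟩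
  rw [← Spec.map_comp_assoc]
  congr 2
  ext a
  exact congrArg Subtype.val (e.apply_symm_apply ⟨φ a, hφ a⟩)

end FieldValuedPoints

section Quotient

variable {S : Scheme.{u}} {G : Type*} {P Y : Over S} {act : G → (P ⟶ P)} {π : P ⟶ Y}

lemma IsQuotient.comp_left (hπ : IsQuotient act π) (g : G) : (act g).left ≫ π.left = π.left := by
  rw [← Over.comp_left, hπ.invariant]

lemma IsQuotient.preimage_le (hπ : IsQuotient act π) (V : Y.left.Opens) (g : G) :
    π.left ⁻¹ᵁ V ≤ (act g).left ⁻¹ᵁ (π.left ⁻¹ᵁ V) :=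
  preimage_le_of_comp_eq (hπ.comp_left g) V

variable [Group G]

lemma IsQuotient.isRingOfInvariants (hπ : IsQuotient act π)
    (hact : IsAction fun g => (act g).left) (V : Y.left.Opens) :
    IsRingOfInvariants (sectionAction hact (π.left ⁻¹ᵁ V) (hπ.preimage_le V))
      (π.left.app V).hom where
  injective := hπ.injective V
  map_apply g b := by
    rw [← Scheme.Hom.appLE_eq_app]
    exact sectionAction_appLE hact hπ.comp_left _ _ g b
  exists_eq a ha := hπ.exists_of_invariant V a fun g _ => ha g

variable [Finite G]

lemma IsQuotient.exists_comp_eq (hπ : IsQuotient act π) (hact : IsAction fun g => (act g).left)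
    {K : Type u} [Field K] [IsAlgClosed K] (y : Spec (CommRingCat.of K) ⟶ Y.left) :
    ∃ p : Spec (CommRingCat.of K) ⟶ P.left, p ≫ π.left = y := by
  have := hπ.affine
  obtain ⟨V, hV, hy⟩ := exists_affineOpen_forall_mem y
  obtain ⟨β, rfl⟩ := exists_eq_specMap_fromSpec hV y hy
  have hinv := hπ.isRingOfInvariants hact V
  obtain ⟨φ, hφ⟩ := exists_comp_eq_of_isIntegral hinv.isIntegral hinv.injective β.hom
  have hW := hV.preimage π.left
  refine ⟨Spec.map (CommRingCat.ofHom φ) ≫ hW.fromSpec, ?_⟩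
  rw [Category.assoc, ← hV.SpecMap_appLE_fromSpec π.left hW le_rfl, ← Spec.map_comp_assoc,
    Scheme.Hom.appLE_eq_app]
  congr 2
  ext1
  exact hφ

lemma IsQuotient.exists_eq_comp (hπ : IsQuotient act π) (hact : IsAction fun g => (act g).left)
    {K : Type u} [Field K] {p p' : Spec (CommRingCat.of K) ⟶ P.left}
    (h : p ≫ π.left = p' ≫ π.left) : ∃ g, p' = p ≫ (act g).left := by
  have := hπ.affine
  obtain ⟨V, hV, hy⟩ := exists_affineOpen_forall_mem (p ≫ π.left)
  have hW := hV.preimage π.left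
  obtain ⟨φ, rfl⟩ := exists_eq_specMap_fromSpec hW p hy
  obtain ⟨ψ, rfl⟩ := exists_eq_specMap_fromSpec hW p' fun x =>
    show (p' ≫ π.left) x ∈ V from h ▸ hy x
  rw [Category.assoc, Category.assoc, ← hV.SpecMap_appLE_fromSpec π.left hW le_rfl,
    ← Spec.map_comp_assoc, ← Spec.map_comp_assoc, Scheme.Hom.appLE_eq_app] at h
  obtain ⟨g, hg⟩ := (hπ.isRingOfInvariants hact V).exists_eq_comp (φ := φ.hom) (ψ := ψ.hom)
    congr(($(specMap_fromSpec_injective hV h)).hom)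
  refine ⟨g, ?_⟩
  rw [Category.assoc, ← hW.SpecMap_appLE_fromSpec (act g).left hW (hπ.preimage_le V g),
    ← Spec.map_comp_assoc]
  congr 2
  ext1
  exact hg

end Quotient

section PointsMap

variable {k : Type u} [Field k] {X : Over (Spec (CommRingCat.of k))}
  {K₁ K₂ K₃ : Type u} [Field K₁] [Algebra k K₁] [Field K₂] [Algebra k K₂] [Field K₃] [Algebra k K₃]

/-- The morphism of spectra over `k` induced by a homomorphism of extension fields of `k`. -/
noncomputable def specOver (α : K₁ →ₐ[k] K₂) :
    Over.mk (Spec.map (CommRingCat.ofHom (algebraMap k K₂))) ⟶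
      Over.mk (Spec.map (CommRingCat.ofHom (algebraMap k K₁))) :=
  Over.homMk (Spec.map (CommRingCat.ofHom α.toRingHom)) (by
    refine (Spec.map_comp _ _).symm.trans (congrArg Spec.map ?_)
    exact congrArg CommRingCat.ofHom α.comp_algebraMap)

lemma specOver_id : specOver (AlgHom.id k K₁) = 𝟙 _ := by
  ext1
  exact Spec.map_id _

lemma specOver_comp (α : K₁ →ₐ[k] K₂) (β : K₂ →ₐ[k] K₃) :
    specOver (β.comp α) = specOver β ≫ specOver α := by
  ext1
  exact Spec.map_comp (CommRingCat.ofHom α.toRingHom) (CommRingCat.ofHom β.toRingHom)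

variable (X) in
/-- The map `X(K₁) → X(K₂)` induced by a homomorphism of extension fields of `k`. -/
noncomputable def pointsMap (α : K₁ →ₐ[k] K₂) (z : Points X K₁) : Points X K₂ := specOver α ≫ z

lemma pointsMap_id : pointsMap X (AlgHom.id k K₁) = id := by
  funext z
  rw [pointsMap, specOver_id, Category.id_comp, id]

lemma pointsMap_comp (α : K₁ →ₐ[k] K₂) (β : K₂ →ₐ[k] K₃) :
    pointsMap X (β.comp α) = pointsMap X β ∘ pointsMap X α := by
  funext z
  rw [pointsMap, specOver_comp, Category.assoc, Function.comp_apply, pointsMap, pointsMap]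

lemma pointsMap_iterate (α : K₁ →ₐ[k] K₁) (n : ℕ) :
    (pointsMap X α)^[n] = pointsMap X (α ^ n) := by
  induction n with
  | zero => exact pointsMap_id.symm
  | succ n ih =>
    rw [Function.iterate_succ, ih, ← pointsMap_comp, pow_succ]
    rfl

lemma pointsMap_injective (α : K₁ →ₐ[k] K₂) : Function.Injective (pointsMap X α) := by
  intro z w hzw
  ext1
  exact (cancel_epi (Spec.map (CommRingCat.ofHom α.toRingHom))).1 congr(($hzw).left)

lemma fixedPoints_pointsMap_eq_range {j : K₁ →ₐ[k] K₂} {F : K₂ →ₐ[k] K₂}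
    (hF : ∀ x, F x = x ↔ x ∈ j.range) :
    Function.fixedPoints (pointsMap X F) = Set.range (pointsMap X j) := by
  ext z
  constructor
  · intro hz
    obtain ⟨q, hq⟩ := exists_specMap_comp_eq_of_forall_mem_range j.toRingHom
      (fun x => (hF x).1) congr(($hz).left)
    refine ⟨Over.homMk q ?_, ?_⟩
    · rw [← cancel_epi (Spec.map (CommRingCat.ofHom j.toRingHom)), ← Category.assoc, hq]
      exact (Over.w z).trans (Over.w (specOver j)).symm
    · ext1
      exact hq
  · rintro ⟨w, rfl⟩
    have hFj : F.comp j = j := AlgHom.ext fun x => (hF (j x)).2 ⟨x, rfl⟩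
    rw [Function.mem_fixedPoints, Function.IsFixedPt, ← Function.comp_apply (f := pointsMap X F),
      ← pointsMap_comp, hFj]

end PointsMap

section FinitelyManyPoints

lemma finite_setOf_ringHom_comp_eq {R A K : Type*} [CommRing R] [CommRing A] [CommRing K]
    [Finite K] {c : R →+* A} (hc : c.FiniteType) (β : R →+* K) :
    {φ : A →+* K | φ.comp c = β}.Finite := by
  let := c.toAlgebra
  let := β.toAlgebra
  obtain ⟨s, hs⟩ := hc.out
  refine Set.Finite.of_injOn (f := fun (φ : A →+* K) (x : s) => φ x) (t := Set.univ)
    (fun _ _ => Set.mem_univ _) ?_ Set.finite_univ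
  intro φ hφ ψ hψ h
  let φ' : A →ₐ[R] K := ⟨φ, fun r => RingHom.congr_fun hφ r⟩
  let ψ' : A →ₐ[R] K := ⟨ψ, fun r => RingHom.congr_fun hψ r⟩
  have : φ' = ψ' := AlgHom.ext_of_adjoin_eq_top hs fun x hx => congrFun h ⟨x, hx⟩
  exact congrArg AlgHom.toRingHom this

variable {k : Type u} [Field k] (X : Over (Spec (CommRingCat.of k))) [LocallyOfFiniteType X.hom]
  (K : Type u) [Field K] [Algebra k K] [Finite K]

lemma finite_points_of_isAffineOpen {W : X.left.Opens} (hW : IsAffineOpen W) :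
    {z : Points X K | ∀ x, z.left x ∈ W}.Finite := by
  have htop := isAffineOpen_top (Spec (CommRingCat.of k))
  obtain ⟨β, hβ⟩ := exists_eq_specMap_fromSpec htop
    (Spec.map (CommRingCat.ofHom (algebraMap k K))) fun _ => trivial
  have hfin := finite_setOf_ringHom_comp_eq (X.hom.finiteType_appLE htop hW le_top) β.hom
  refine Set.Finite.of_finite_image (f := Over.Hom.left) ?_ fun z _ w _ h => Over.OverMorphism.ext h
  refine (hfin.image fun φ => Spec.map (CommRingCat.ofHom φ) ≫ hW.fromSpec).subset ?_
  rintro _ ⟨z, hz, rfl⟩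
  obtain ⟨φ, hφ⟩ := exists_eq_specMap_fromSpec hW z.left hz
  have hφβ : Spec.map (X.hom.appLE ⊤ W le_top ≫ φ) ≫ htop.fromSpec =
      Spec.map β ≫ htop.fromSpec := by
    rw [Spec.map_comp_assoc, htop.SpecMap_appLE_fromSpec X.hom hW le_top, ← Category.assoc, ← hφ,
      ← hβ]
    exact Over.w z
  exact ⟨φ.hom, congr(($(specMap_fromSpec_injective htop hφβ)).hom), hφ.symm⟩

variable [QuasiCompact X.hom]

lemma finite_points : Finite (Points X K) := by
  have : CompactSpace X.left := (quasiCompact_iff_compactSpace (f := X.hom)).1 inferInstance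
  choose W hW hxW using fun x : X.left =>
    exists_isAffineOpen_mem_and_subset (x := x) (U := ⊤) trivial
  obtain ⟨t, ht⟩ := isCompact_univ.elim_finite_subcover (fun x => (W x : Set X.left))
    (fun x => (W x).isOpen) fun x _ => Set.mem_iUnion.2 ⟨x, (hxW x).1⟩
  rw [← Set.finite_univ_iff]
  refine (t.finite_toSet.biUnion fun x _ => finite_points_of_isAffineOpen X K (hW x)).subset ?_
  intro z _
  let x₀ : Spec (CommRingCat.of K) := default
  obtain ⟨y, hy, hzy⟩ := Set.mem_iUnion₂.1 (ht (Set.mem_univ (z.left x₀)))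
  exact Set.mem_iUnion₂.2 ⟨y, hy, fun x => Subsingleton.elim (α := Spec (.of K)) x₀ x ▸ hzy⟩

end FinitelyManyPoints

section Frobenius

open Polynomial

variable {k : Type u} [Field k] [Fintype k]

lemma frobeniusAlgHom_pow_apply {A : Type*} [CommRing A] [Algebra k A] (n : ℕ) (x : A) :
    (FiniteField.frobeniusAlgHom k A ^ n) x = x ^ (Nat.card k ^ n) := by
  rw [AlgHom.coe_pow, FiniteField.coe_frobeniusAlgHom, pow_iterate, Nat.card_eq_fintype_card]

lemma frobeniusAlgHom_pow_apply_eq_self_iff {K' K : Type*} [Field K'] [Algebra k K'] [Field K]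
    [Algebra k K] {n : ℕ} (hn : n ≠ 0) [IsSplittingField k K' (X ^ (Nat.card k ^ n) - X)]
    (j : K' →ₐ[k] K) (x : K) :
    (FiniteField.frobeniusAlgHom k K ^ n) x = x ↔ x ∈ j.range := by
  have hroot (y : K) : y ∈ (X ^ (Nat.card k ^ n) - X : k[X]).rootSet K ↔
      (FiniteField.frobeniusAlgHom k K ^ n) y = y := by
    have hne : (X ^ (Nat.card k ^ n) - X : k[X]) ≠ 0 :=
      FiniteField.X_pow_card_sub_X_ne_zero _ (Nat.one_lt_pow hn Finite.one_lt_card)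
    rw [mem_rootSet_of_ne hne, frobeniusAlgHom_pow_apply]
    simp [sub_eq_zero]
  rw [← IsSplittingField.adjoin_rootSet_eq_range K' (X ^ (Nat.card k ^ n) - X) j]
  refine ⟨fun hx => Algebra.subset_adjoin ((hroot x).2 hx), fun hx => ?_⟩
  exact Algebra.adjoin_le (S := AlgHom.equalizer (FiniteField.frobeniusAlgHom k K ^ n)
    (AlgHom.id k K)) (fun y hy => (hroot y).1 hy) hx

variable {X : Over (Spec (CommRingCat.of k))} {K' K : Type u} [Field K'] [Algebra k K'] [Field K]
  [Algebra k K]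

variable (X K) in
/-- The map `X(K) → X(K)` induced by the endomorphism `x ↦ x ^ q` of `K`, where `q = |k|`. -/
noncomputable abbrev frobeniusOnPoints : Points X K → Points X K :=
  pointsMap X (FiniteField.frobeniusAlgHom k K)

lemma ptsOfPeriod_frobeniusOnPoints {n : ℕ} (hn : n ≠ 0)
    [IsSplittingField k K' (Polynomial.X ^ (Nat.card k ^ n) - Polynomial.X)] (j : K' →ₐ[k] K) :
    Function.ptsOfPeriod (frobeniusOnPoints X K) n =
      Set.range (pointsMap X j) := by
  rw [← fixedPoints_pointsMap_eq_range (frobeniusAlgHom_pow_apply_eq_self_iff hn j),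
    ← pointsMap_iterate]
  rfl

lemma fixedPoints_frobeniusOnPoints :
    Function.fixedPoints (frobeniusOnPoints X K) =
      Set.range (pointsMap X (Algebra.ofId k K)) := by
  have : IsSplittingField k k (Polynomial.X ^ (Nat.card k ^ 1) - Polynomial.X) := by
    rw [pow_one, Nat.card_eq_fintype_card]
    infer_instance
  exact ptsOfPeriod_frobeniusOnPoints one_ne_zero _

end Frobenius

section Tuples

lemma map_univ_eq_map_univ_iff {ι α : Type*} [Fintype ι] {a b : ι → α} :
    Finset.univ.val.map a = Finset.univ.val.map b ↔ ∃ σ : Equiv.Perm ι, b = a ∘ σ := by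
  classical
  constructor
  · intro hab
    have hfiber (c : α) : Nonempty ({x // b x = c} ≃ {x // a x = c}) := by
      have hcount := congrArg (Multiset.count c) hab
      simp only [Multiset.count_map, eq_comm (a := c)] at hcount
      rw [← Fintype.card_eq, Fintype.card_subtype, Fintype.card_subtype]
      exact hcount.symm
    refine ⟨Equiv.ofFiberEquiv fun c => (hfiber c).some, funext fun x => ?_⟩
    exact (Equiv.ofFiberEquiv_map _ x).symm
  · rintro ⟨σ, rfl⟩
    rw [← Multiset.map_map, Multiset.map_univ_val_equiv]

lemma exists_map_univ_eq {α : Type*} {n : ℕ} {m : Multiset α} (hm : m.card = n) :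
    ∃ a : Fin n → α, Finset.univ.val.map a = m := by
  subst hm
  induction m using Quot.inductionOn with
  | h l => exact ⟨l.get, (Fin.univ_val_map _).trans (congrArg _ (List.ofFn_get l))⟩

end Tuples

section Permute

variable {S : Scheme.{u}} {X : Over S} {n : ℕ}

lemma lift_permute {T : Over S} (a : Fin n → (T ⟶ X)) (σ : Equiv.Perm (Fin n)) :
    Pi.lift a ≫ permute X n σ = Pi.lift (a ∘ σ) := by
  refine Pi.hom_ext _ _ fun i => ?_
  rw [Category.assoc, permute, Pi.lift_π, Pi.lift_π, Pi.lift_π, Function.comp_apply]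

lemma lift_injective {T : Over S} :
    Function.Injective fun a : Fin n → (T ⟶ X) => Pi.lift a := by
  intro a b hab
  funext i
  rw [← Pi.lift_π a i, ← Pi.lift_π b i]
  exact congrArg (· ≫ Pi.π (fun _ => X) i) hab

lemma exists_lift_eq {T : Over S} (p : T ⟶ power X n) : ∃ a : Fin n → (T ⟶ X), Pi.lift a = p :=
  ⟨fun i => p ≫ Pi.π _ i, Pi.hom_ext _ _ fun _ => Pi.lift_π _ _⟩

variable (X n)

lemma permute_one : permute X n 1 = 𝟙 _ := by
  refine Pi.hom_ext _ _ fun i => ?_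
  rw [permute, Pi.lift_π, Category.id_comp, Equiv.Perm.one_apply]

lemma permute_mul (σ τ : Equiv.Perm (Fin n)) :
    permute X n (σ * τ) = permute X n σ ≫ permute X n τ := by
  conv_rhs => rw [permute, lift_permute]
  rfl

lemma isAction_permute : IsAction fun σ => (permute X n σ).left where
  map_one := by rw [permute_one, Over.id_left]
  map_mul σ τ := by rw [permute_mul, Over.comp_left]

end Permute

section Counting

variable {k : Type u} [Field k] {X : Over (Spec (CommRingCat.of k))} {n : ℕ}
  {Y : Over (Spec (CommRingCat.of k))} {π : power X n ⟶ Y}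

/-- The point `x₁ + ⋯ + xₙ` of the symmetric product given by `n` points of `X`. -/
noncomputable def sumPoint (π : power X n ⟶ Y) {K : Type u} [Field K] [Algebra k K]
    (a : Fin n → Points X K) : Points Y K :=
  Pi.lift a ≫ π

lemma pointsMap_sumPoint {K₁ K₂ : Type u} [Field K₁] [Algebra k K₁] [Field K₂] [Algebra k K₂]
    (α : K₁ →ₐ[k] K₂) (a : Fin n → Points X K₁) :
    pointsMap Y α (sumPoint π a) = sumPoint π (pointsMap X α ∘ a) := by
  rw [pointsMap, sumPoint, sumPoint, ← Category.assoc]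
  congr 1
  refine Pi.hom_ext _ _ fun i => ?_
  rw [Category.assoc, Pi.lift_π, Pi.lift_π, Function.comp_apply, pointsMap]

variable {K : Type u} [Field K] [Algebra k K]

lemma sumPoint_surjective [IsAlgClosed K] (hπ : IsSymmetricProduct X n π) :
    Function.Surjective (sumPoint π (K := K)) := by
  intro y
  obtain ⟨p, hp⟩ := IsQuotient.exists_comp_eq hπ (isAction_permute X n) y.left
  have hpk : p ≫ (power X n).hom = Spec.map (CommRingCat.ofHom (algebraMap k K)) := by
    rw [← Over.w π, ← Category.assoc, hp]
    exact Over.w y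
  obtain ⟨a, ha⟩ := exists_lift_eq (Over.homMk p hpk : Points (power X n) K)
  refine ⟨a, ?_⟩
  rw [sumPoint, ha]
  ext1
  exact hp

lemma sumPoint_eq_sumPoint_iff (hπ : IsSymmetricProduct X n π) {a b : Fin n → Points X K} :
    sumPoint π a = sumPoint π b ↔ Finset.univ.val.map a = Finset.univ.val.map b := by
  rw [map_univ_eq_map_univ_iff]
  constructor
  · intro h
    obtain ⟨σ, hσ⟩ := IsQuotient.exists_eq_comp hπ (isAction_permute X n)
      (p := (Pi.lift a).left) (p' := (Pi.lift b).left) congr(($h).left)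
    have hba : Pi.lift b = Pi.lift a ≫ permute X n σ := Over.OverMorphism.ext hσ
    exact ⟨σ, lift_injective (hba.trans (lift_permute a σ))⟩
  · rintro ⟨σ, rfl⟩
    rw [sumPoint, sumPoint, ← lift_permute, Category.assoc, hπ.invariant]

lemma bijOn_map_univ_of_sumPoint_eq (hπ : IsSymmetricProduct X n π) (F : K →ₐ[k] K)
    {s : Points Y K → Fin n → Points X K} (hs : ∀ y, sumPoint π (s y) = y) :
    Set.BijOn (fun y => Finset.univ.val.map (s y)) (Function.fixedPoints (pointsMap Y F))
      (invariantMultisets (pointsMap X F) n) := by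
  have hinv (a : Fin n → Points X K) :
      (Finset.univ.val.map a).map (pointsMap X F) = Finset.univ.val.map a ↔
        pointsMap Y F (sumPoint π a) = sumPoint π a := by
    rw [Multiset.map_map, ← sumPoint_eq_sumPoint_iff hπ, ← pointsMap_sumPoint]
  refine ⟨fun y hy => ⟨by simp, (hinv _).2 (by rwa [hs])⟩, fun y _ y' _ hyy' => ?_, ?_⟩
  · rw [← hs y, ← hs y']
    exact (sumPoint_eq_sumPoint_iff hπ).2 hyy'
  · rintro m ⟨hm, hmF⟩
    obtain ⟨a, rfl⟩ := exists_map_univ_eq hm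
    exact ⟨sumPoint π a, (hinv a).1 hmF, (sumPoint_eq_sumPoint_iff hπ).1 (hs _)⟩

lemma card_points_eq_ncard_invariantMultisets [Fintype k] (hπ : IsSymmetricProduct X n π) :
    Nat.card (Points Y k) = (invariantMultisets
      (frobeniusOnPoints X (AlgebraicClosure k)) n).ncard := by
  choose s hs using sumPoint_surjective (K := AlgebraicClosure k) hπ
  have hbij := bijOn_map_univ_of_sumPoint_eq hπ (FiniteField.frobeniusAlgHom k _) hs
  rw [← hbij.image_eq, hbij.injOn.ncard_image, fixedPoints_frobeniusOnPoints,
    ← Nat.card_coe_set_eq, Nat.card_range_of_injective (pointsMap_injective _)]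

lemma finite_points_iff_finite_invariantMultisets [Fintype k] (hπ : IsSymmetricProduct X n π) :
    Finite (Points Y k) ↔ (invariantMultisets
      (frobeniusOnPoints X (AlgebraicClosure k)) n).Finite := by
  choose s hs using sumPoint_surjective (K := AlgebraicClosure k) hπ
  have hbij := bijOn_map_univ_of_sumPoint_eq hπ (FiniteField.frobeniusAlgHom k _) hs
  rw [← hbij.image_eq, Set.finite_image_iff hbij.injOn, fixedPoints_frobeniusOnPoints,
    Set.finite_range_iff (pointsMap_injective _)]

end Counting

section ZetaFunction

variable {k : Type u} [Field k] {X : Over (Spec (CommRingCat.of k))}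

lemma ptsOfPeriod_frobeniusOnPoints_eq_range_ext [Fintype k] {n : ℕ} (hn : n ≠ 0) :
    Function.ptsOfPeriod (frobeniusOnPoints X (AlgebraicClosure k)) n =
      Set.range (pointsMap X (IsAlgClosed.lift : Ext k n →ₐ[k] AlgebraicClosure k)) :=
  ptsOfPeriod_frobeniusOnPoints hn _

lemma finite_ptsOfPeriod_frobeniusOnPoints [Fintype k] {n : ℕ} (hn : n ≠ 0)
    [Finite (Points X (Ext k n))] : (Function.ptsOfPeriod
      (frobeniusOnPoints X (AlgebraicClosure k)) n).Finite := by
  rw [ptsOfPeriod_frobeniusOnPoints_eq_range_ext hn]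
  exact Set.finite_range _

lemma ncard_ptsOfPeriod_frobeniusOnPoints [Fintype k] {n : ℕ} (hn : n ≠ 0) :
    (Function.ptsOfPeriod (frobeniusOnPoints X (AlgebraicClosure k))
      n).ncard = Nat.card (Points X (Ext k n)) := by
  rw [ptsOfPeriod_frobeniusOnPoints_eq_range_ext hn, ← Nat.card_coe_set_eq,
    Nat.card_range_of_injective (pointsMap_injective _)]

variable [Finite k] (hX : ∀ n ≠ 0, Finite (Points X (Ext k n)))
include hX

lemma finite_points_of_isSymmetricProduct {n : ℕ} {Y : Over (Spec (CommRingCat.of k))}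
    {π : power X n ⟶ Y} (hπ : IsSymmetricProduct X n π) : Finite (Points Y k) := by
  cases nonempty_fintype k
  refine (finite_points_iff_finite_invariantMultisets hπ).2
    (invariantMultisets_finite (pointsMap_injective _) (fun j hj => ?_) n)
  have := hX j (Nat.one_le_iff_ne_zero.1 hj)
  exact finite_ptsOfPeriod_frobeniusOnPoints (Nat.one_le_iff_ne_zero.1 hj)

lemma mk_card_points_eq_hasseWeil {Y : ℕ → Over (Spec (CommRingCat.of k))}
    {π : ∀ n, power X n ⟶ Y n} (hπ : ∀ n, IsSymmetricProduct X n (π n)) :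
    PowerSeries.mk (fun n => (Nat.card (Points (Y n) k) : ℚ)) = hasseWeil X := by
  cases nonempty_fintype k
  simp only [fun n => card_points_eq_ncard_invariantMultisets (hπ n)]
  refine mk_eq_exp_subst_of_recurrence ncard_invariantMultisets_zero fun n => ?_
  rw [mul_ncard_invariantMultisets (pointsMap_injective _) fun j hj => ?_]
  · refine Finset.sum_congr rfl fun j hj => ?_
    rw [ncard_ptsOfPeriod_frobeniusOnPoints
      (Nat.one_le_iff_ne_zero.1 (Finset.mem_Icc.1 hj).1)]
  · have := hX j (Nat.one_le_iff_ne_zero.1 hj)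
    exact finite_ptsOfPeriod_frobeniusOnPoints (Nat.one_le_iff_ne_zero.1 hj)

end ZetaFunction

section OpenImmersion

lemma isOpenImmersion_of_isLocalIso {X Y : Scheme.{u}} (f : X ⟶ Y) [h : IsLocalIso f]
    (hf : Function.Injective f) : IsOpenImmersion f := by
  have hcov (x : X) : ∃ (U : X.Opens) (y : U.toScheme), U.ι y = x ∧ IsOpenImmersion (U.ι ≫ f) := by
    obtain ⟨U, hxU, hU⟩ := h.exists_isOpenImmersion x
    exact ⟨U, ⟨x, hxU⟩, rfl, hU⟩
  have hiso (x : X) : IsIso (f.stalkMap x) := by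
    obtain ⟨U, y, rfl, hU⟩ := hcov x
    have hcomp : IsIso ((U.ι ≫ f).stalkMap y) := inferInstance
    rw [Scheme.Hom.stalkMap_comp] at hcomp
    exact (isIso_comp_right_iff _ _).1 hcomp
  have hopen : IsOpenMap f := isOpenMap_iff_nhds_le.2 fun x => by
    obtain ⟨U, y, rfl, hU⟩ := hcov x
    rw [← U.ι.isOpenEmbedding.map_nhds_eq, Filter.map_map]
    exact ((U.ι ≫ f).isOpenEmbedding.map_nhds_eq y).ge
  exact IsOpenImmersion.of_isIso_stalkMap f
    (Topology.IsOpenEmbedding.of_continuous_injective_isOpenMap f.continuous hf hopen)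

lemma isOpenImmersion_basicOpen_ι_comp_specMap {B B' : CommRingCat.{u}} (s : B ⟶ B') (f : B)
    (hker : ∀ b, s b = 0 → ∃ n : ℕ, f ^ n * b = 0)
    (hsurj : ∀ b', ∃ (n : ℕ) (b : B), s b = s f ^ n * b') :
    IsOpenImmersion (Scheme.Opens.ι (X := Spec B') (PrimeSpectrum.basicOpen (s f)) ≫
      Spec.map s) := by
  let L := Localization.Away (s f)
  let : Algebra B L := ((algebraMap B' L).comp s.hom).toAlgebra
  have : IsLocalization.Away f L := isLocalizationAway_of_comp (s := s.hom) rfl hker hsurj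
  let j := Spec.map (CommRingCat.ofHom (algebraMap B' L))
  have hj : IsOpenImmersion j := IsOpenImmersion.of_isLocalization (s f)
  have hcomp : IsOpenImmersion (j ≫ Spec.map s) := by
    rw [← Spec.map_comp]
    exact IsOpenImmersion.of_isLocalization (R := B) (S := L) f
  have hrange : j.opensRange = PrimeSpectrum.basicOpen (s f) :=
    Scheme.Hom.opensRange_localizationAway (s f)
  rw [← hrange, ← j.isoOpensRange_inv_comp, Category.assoc]
  infer_instance

end OpenImmersion

section Restriction

variable {P : Scheme.{u}} {U V : P.Opens} (h : U ≤ V) {f : Γ(P, V)}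

lemma exists_pow_mul_eq_zero_of_map_eq_zero (hV : IsAffineOpen V) (hf : P.basicOpen f ≤ U)
    {a : Γ(P, V)} (ha : P.presheaf.map (homOfLE h).op a = 0) : ∃ n : ℕ, f ^ n * a = 0 := by
  refine exists_pow_mul_eq_zero_of_res_basicOpen_eq_zero_of_isCompact P hV.isCompact a f ?_
  have hcomp : P.presheaf.map (homOfLE h).op ≫ P.presheaf.map (homOfLE hf).op =
      P.presheaf.map (homOfLE (P.basicOpen_le f)).op := (P.presheaf.map_comp _ _).symm
  refine congr($hcomp.symm a).trans ?_
  rw [CommRingCat.comp_apply, ha, map_zero]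

lemma exists_map_eq_pow_mul (hU : IsAffineOpen U) (hV : IsAffineOpen V) (hf : P.basicOpen f ≤ U)
    (b : Γ(P, U)) : ∃ (n : ℕ) (a : Γ(P, V)),
      P.presheaf.map (homOfLE h).op a = P.presheaf.map (homOfLE h).op f ^ n * b := by
  have hcomp : P.presheaf.map (homOfLE h).op ≫ P.presheaf.map (homOfLE hf).op =
      P.presheaf.map (homOfLE (P.basicOpen_le f)).op := (P.presheaf.map_comp _ _).symm
  have hle : P.basicOpen (P.presheaf.map (homOfLE h).op f) ≤ P.basicOpen f := by
    rw [Scheme.basicOpen_res]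
    exact inf_le_right
  obtain ⟨n, a, ha⟩ := exists_eq_pow_mul_of_isAffineOpen P V hV f
    (P.presheaf.map (homOfLE hf).op b)
  obtain ⟨m, hm⟩ := exists_pow_mul_eq_zero_of_map_eq_zero hf hU hle
    (a := P.presheaf.map (homOfLE h).op a - P.presheaf.map (homOfLE h).op f ^ n * b) (by
      rw [map_sub, map_mul, map_pow, sub_eq_zero, ← CommRingCat.comp_apply,
        ← CommRingCat.comp_apply, hcomp]
      exact ha)
  refine ⟨m + n, f ^ m * a, ?_⟩
  rw [map_mul, map_pow, pow_add, mul_assoc]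
  exact sub_eq_zero.1 ((mul_sub _ _ _).symm.trans hm)

end Restriction

section LocalQuotients

variable {P : Scheme.{u}} {G : Type*} {ρ : G → (P ⟶ P)}

variable (ρ) in
/-- An affine open subset of `P` that is stable under the action `ρ`. These index the affine pieces
`Spec Γ(P, W)ᴳ` from which the quotient of `P` is glued. -/
structure InvariantAffineOpen where
  opens : P.Opens
  isAffineOpen : IsAffineOpen opens
  le_preimage : ∀ g, opens ≤ ρ g ⁻¹ᵁ opens

namespace InvariantAffineOpen

instance : Preorder (InvariantAffineOpen ρ) := Preorder.lift opens

section Embedding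

variable {W W' W'' : InvariantAffineOpen ρ}

/-- The restriction of sections between invariant affine open subsets. -/
def res (h : W ≤ W') : Γ(P, W'.opens) ⟶ Γ(P, W.opens) :=
  P.presheaf.map (homOfLE (show W.opens ≤ W'.opens from h)).op

lemma res_comp (h : W ≤ W') (h' : W' ≤ W'') : res h' ≫ res h = res (h.trans h') := by
  rw [res, res, ← Functor.map_comp]
  rfl

lemma res_refl (W : InvariantAffineOpen ρ) : res (le_refl W) = 𝟙 _ := P.presheaf.map_id _

variable (W) in
/-- The open immersion `Spec Γ(P, W) ⟶ P` with image `W`. -/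
noncomputable def emb : Spec Γ(P, W.opens) ⟶ P := W.isAffineOpen.fromSpec

instance : IsOpenImmersion W.emb := W.isAffineOpen.isOpenImmersion_fromSpec

variable (W) in
lemma range_emb : Set.range W.emb = W.opens := W.isAffineOpen.range_fromSpec

lemma emb_mem (z : Spec Γ(P, W.opens)) : W.emb z ∈ W.opens := W.range_emb.subset ⟨z, rfl⟩

lemma exists_emb_eq {x : P} (hx : x ∈ W.opens) : ∃ z, W.emb z = x := W.range_emb.superset hx

lemma emb_injective : Function.Injective W.emb := W.emb.isOpenEmbedding.injective

lemma specMap_res_emb (h : W ≤ W') : Spec.map (res h) ≫ W'.emb = W.emb :=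
  W'.isAffineOpen.map_fromSpec W.isAffineOpen _

lemma emb_specMap_res (h : W ≤ W') (z : Spec Γ(P, W.opens)) :
    W'.emb (Spec.map (res h) z) = W.emb z := by
  rw [← Scheme.Hom.comp_apply, specMap_res_emb]

variable (W) in
lemma specMap_act_emb (g : G) :
    Spec.map ((ρ g).appLE W.opens W.opens (W.le_preimage g)) ≫ W.emb = W.emb ≫ ρ g :=
  W.isAffineOpen.SpecMap_appLE_fromSpec (ρ g) W.isAffineOpen (W.le_preimage g)

lemma emb_specMap_act (g : G) (z : Spec Γ(P, W.opens)) :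
    W.emb (Spec.map ((ρ g).appLE W.opens W.opens (W.le_preimage g)) z) = ρ g (W.emb z) := by
  rw [← Scheme.Hom.comp_apply, specMap_act_emb, Scheme.Hom.comp_apply]

end Embedding

variable [Group G] (hρ : IsAction ρ) (W : InvariantAffineOpen ρ)

/-- The ring `Γ(P, W)ᴳ` of invariant sections. -/
def invRing : Subring Γ(P, W.opens) where
  carrier := {s | ∀ g, sectionAction hρ W.opens W.le_preimage g s = s}
  mul_mem' ha hb g := by rw [map_mul, ha g, hb g]
  one_mem' g := map_one _
  add_mem' ha hb g := by rw [map_add, ha g, hb g]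
  zero_mem' g := map_zero _
  neg_mem' ha g := by rw [map_neg, ha g]

lemma isRingOfInvariants_subtype :
    IsRingOfInvariants (sectionAction hρ W.opens W.le_preimage) (W.invRing hρ).subtype where
  injective := Subtype.val_injective
  map_apply g b := b.2 g
  exists_eq a ha := ⟨⟨a, ha⟩, rfl⟩

/-- The inclusion `Γ(P, W)ᴳ ⟶ Γ(P, W)` in the category of rings. -/
def incl : CommRingCat.of (W.invRing hρ) ⟶ Γ(P, W.opens) :=
  CommRingCat.ofHom (W.invRing hρ).subtype

instance : Mono (W.incl hρ) := ConcreteCategory.mono_of_injective _ Subtype.val_injective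

variable {W} {W' : InvariantAffineOpen ρ}

lemma res_comp_sectionAction (h : W ≤ W') (g : G) :
    (res h).hom.comp (sectionAction hρ W'.opens W'.le_preimage g) =
      (sectionAction hρ W.opens W.le_preimage g).comp (res h).hom :=
  map_comp_sectionAction hρ h _ _ g

/-- The restriction of invariant sections. -/
def invRes (h : W ≤ W') : CommRingCat.of (W'.invRing hρ) ⟶ CommRingCat.of (W.invRing hρ) :=
  CommRingCat.ofHom (((res h).hom.comp (W'.invRing hρ).subtype).codRestrict _ fun s g =>
    (RingHom.congr_fun (res_comp_sectionAction hρ h g) s.1).symm.trans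
      (congrArg (res h) (s.2 g)))

lemma invRes_incl (h : W ≤ W') : invRes hρ h ≫ W.incl hρ = W'.incl hρ ≫ res h := rfl

variable (ρ) in
/-- The affine quotients `Spec Γ(P, W)ᴳ` of the invariant affine open subsets `W`. -/
noncomputable def quotientFunctor : InvariantAffineOpen ρ ⥤ Scheme.{u} where
  obj W := Spec (CommRingCat.of (W.invRing hρ))
  map f := Spec.map (invRes hρ (leOfHom f))
  map_id W := by
    rw [← Spec.map_id, Spec.map_inj, ← cancel_mono (W.incl hρ), invRes_incl, res_refl,
      Category.comp_id, Category.id_comp]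
  map_comp {W W' W''} f f' := by
    rw [← Spec.map_comp, Spec.map_inj, ← cancel_mono (W.incl hρ), Category.assoc, invRes_incl,
      invRes_incl, ← Category.assoc, invRes_incl, Category.assoc, res_comp]

variable (W) in
/-- The quotient map `W ⟶ Spec Γ(P, W)ᴳ`. -/
noncomputable def quot : Spec Γ(P, W.opens) ⟶ (quotientFunctor ρ hρ).obj W :=
  Spec.map (W.incl hρ)

lemma specMap_res_quot (h : W ≤ W') :
    Spec.map (res h) ≫ W'.quot hρ = W.quot hρ ≫ (quotientFunctor ρ hρ).map (homOfLE h) := by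
  change Spec.map (res h) ≫ Spec.map (W'.incl hρ) = Spec.map (W.incl hρ) ≫ Spec.map (invRes hρ h)
  rw [← Spec.map_comp, ← Spec.map_comp, invRes_incl]

lemma map_quot_apply (h : W ≤ W') (z : Spec Γ(P, W.opens)) :
    (quotientFunctor ρ hρ).map (homOfLE h) (W.quot hρ z) = W'.quot hρ (Spec.map (res h) z) := by
  rw [← Scheme.Hom.comp_apply, ← Scheme.Hom.comp_apply, specMap_res_quot]

variable (W) in
lemma specMap_act_quot (g : G) :
    Spec.map ((ρ g).appLE W.opens W.opens (W.le_preimage g)) ≫ W.quot hρ = W.quot hρ := by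
  change Spec.map _ ≫ Spec.map (W.incl hρ) = Spec.map (W.incl hρ)
  rw [← Spec.map_comp]
  congr 1
  ext b
  exact b.2 g

lemma quot_eq_of_emb_eq {z z' : Spec Γ(P, W.opens)} {g : G} (h : W.emb z' = ρ g (W.emb z)) :
    W.quot hρ z = W.quot hρ z' := by
  rw [← emb_specMap_act] at h
  rw [emb_injective h, ← Scheme.Hom.comp_apply, specMap_act_quot]

variable (W) in
lemma emb_mem_basicOpen_iff (f : W.invRing hρ) (z : Spec Γ(P, W.opens)) :
    W.emb z ∈ P.basicOpen f.1 ↔ W.quot hρ z ∈ PrimeSpectrum.basicOpen f := by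
  change z ∈ W.isAffineOpen.fromSpec ⁻¹ᵁ P.basicOpen f.1 ↔ z ∈ PrimeSpectrum.basicOpen f.1
  rw [W.isAffineOpen.fromSpec_preimage_basicOpen f.1]
  rfl

variable (W) in
/-- The invariant affine open subset on which an invariant section is invertible. -/
def basicOpen (f : W.invRing hρ) : InvariantAffineOpen ρ where
  opens := P.basicOpen f.1
  isAffineOpen := W.isAffineOpen.basicOpen f.1
  le_preimage g := by
    have hf : (ρ g).appLE W.opens W.opens (W.le_preimage g) f.1 = f.1 := f.2 g
    rw [Scheme.preimage_basicOpen]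
    conv_lhs => rw [← hf]
    rw [Scheme.Hom.appLE, CommRingCat.comp_apply, Scheme.basicOpen_res]
    exact inf_le_right

lemma basicOpen_le (f : W.invRing hρ) : W.basicOpen hρ f ≤ W := P.basicOpen_le f.1

variable [Finite G]

lemma quot_surjective : Function.Surjective (W.quot hρ) :=
  (W.isRingOfInvariants_subtype hρ).comap_surjective

lemma exists_emb_eq_of_quot_eq {z z' : Spec Γ(P, W.opens)} (h : W.quot hρ z = W.quot hρ z') :
    ∃ g, W.emb z' = ρ g (W.emb z) := by
  obtain ⟨g, rfl⟩ := (W.isRingOfInvariants_subtype hρ).exists_eq_comap h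
  exact ⟨g, emb_specMap_act g z⟩

/-- The complement of `O` in `W` is closed and stable, so its image in `Spec Γ(P, W)ᴳ` is a closed
set that does not contain the image of `x`. -/
lemma exists_mem_basicOpen_le {O : P.Opens} (hO : ∀ g, O ≤ ρ g ⁻¹ᵁ O) {x : P}
    (hxW : x ∈ W.opens) (hxO : x ∈ O) :
    ∃ f : W.invRing hρ, x ∈ (W.basicOpen hρ f).opens ∧ (W.basicOpen hρ f).opens ≤ O := by
  obtain ⟨z, rfl⟩ := exists_emb_eq hxW
  let C : Set (Spec Γ(P, W.opens)) := (W.emb ⁻¹ᵁ O : Set _)ᶜ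
  have hC : IsClosed (W.quot hρ '' C) := PrimeSpectrum.isClosedMap_comap_of_isIntegral _
    (W.isRingOfInvariants_subtype hρ).isIntegral C (W.emb ⁻¹ᵁ O).isOpen.isClosed_compl
  have hz : W.quot hρ z ∉ W.quot hρ '' C := by
    rintro ⟨z', hz', h⟩
    obtain ⟨g, hg⟩ := exists_emb_eq_of_quot_eq hρ h.symm
    apply hz'
    change W.emb z' ∈ O
    rw [hg]
    exact hO g hxO
  obtain ⟨_, ⟨f, rfl⟩, hzf, hf⟩ :=
    PrimeSpectrum.isTopologicalBasis_basic_opens.exists_subset_of_mem_open hz hC.isOpen_compl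
  refine ⟨f, (W.emb_mem_basicOpen_iff hρ f z).2 hzf, fun y hy => ?_⟩
  obtain ⟨w, rfl⟩ := exists_emb_eq (basicOpen_le hρ f hy)
  by_contra hw
  exact hf ((W.emb_mem_basicOpen_iff hρ f w).1 hy) ⟨w, hw, rfl⟩

include hρ in
lemma exists_le_le {x : P} (hx : x ∈ W.opens) (hx' : x ∈ W'.opens) :
    ∃ W'' : InvariantAffineOpen ρ, W'' ≤ W ∧ W'' ≤ W' ∧ x ∈ W''.opens := by
  obtain ⟨f, hxf, hf⟩ := exists_mem_basicOpen_le hρ W'.le_preimage hx hx'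
  exact ⟨W.basicOpen hρ f, basicOpen_le hρ f, hf, hxf⟩

lemma quotientFunctor_map_injective (h : W ≤ W') :
    Function.Injective ((quotientFunctor ρ hρ).map (homOfLE h)) := by
  intro y y' hy
  obtain ⟨z, rfl⟩ := quot_surjective hρ y
  obtain ⟨z', rfl⟩ := quot_surjective hρ y'
  rw [map_quot_apply, map_quot_apply] at hy
  obtain ⟨g, hg⟩ := exists_emb_eq_of_quot_eq hρ hy
  rw [emb_specMap_res, emb_specMap_res] at hg
  exact quot_eq_of_emb_eq hρ hg

lemma isOpenImmersion_basicOpen_ι_comp_specMap_invRes (h : W ≤ W') {f : W'.invRing hρ}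
    (hf : (W'.basicOpen hρ f).opens ≤ W.opens) :
    IsOpenImmersion (Scheme.Opens.ι (X := Spec (CommRingCat.of (W.invRing hρ)))
      (PrimeSpectrum.basicOpen (invRes hρ h f)) ≫ Spec.map (invRes hρ h)) := by
  have hker (a) (ha : res h a = 0) : ∃ n : ℕ, f.1 ^ n * a = 0 :=
    exists_pow_mul_eq_zero_of_map_eq_zero h W'.isAffineOpen hf ha
  refine isOpenImmersion_basicOpen_ι_comp_specMap (invRes hρ h) f ?_ ?_
  · exact fun b => exists_pow_mul_eq_zero_of_comp_eq (r := (res h).hom)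
      (i' := (W.invRing hρ).subtype) (W'.isRingOfInvariants_subtype hρ).injective rfl hker
  · exact (W'.isRingOfInvariants_subtype hρ).exists_map_eq_pow_mul
      (W.isRingOfInvariants_subtype hρ) rfl (res_comp_sectionAction hρ h) hker
      (exists_map_eq_pow_mul h W.isAffineOpen W'.isAffineOpen hf)

lemma isLocalIso_specMap_invRes (h : W ≤ W') : IsLocalIso (Spec.map (invRes hρ h)) := by
  refine ⟨fun y => ?_⟩
  obtain ⟨z, rfl⟩ := quot_surjective hρ y
  obtain ⟨f, hzf, hf⟩ := exists_mem_basicOpen_le hρ W.le_preimage (h (emb_mem z)) (emb_mem z)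
  refine ⟨PrimeSpectrum.basicOpen (invRes hρ h f), ?_,
    isOpenImmersion_basicOpen_ι_comp_specMap_invRes hρ h hf⟩
  refine (W.emb_mem_basicOpen_iff hρ (invRes hρ h f) z).1 ?_
  change W.emb z ∈ P.basicOpen (res h f.1)
  rw [res, Scheme.basicOpen_res]
  exact ⟨emb_mem z, hzf⟩

instance (f : W ⟶ W') : IsOpenImmersion ((quotientFunctor ρ hρ).map f) :=
  have := isLocalIso_specMap_invRes hρ (leOfHom f)
  isOpenImmersion_of_isLocalIso (Spec.map (invRes hρ (leOfHom f)))
    (quotientFunctor_map_injective hρ (leOfHom f))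

lemma exists_quotientFunctor_map_eq {W₁ W₂ : InvariantAffineOpen ρ} (h₁ : W₁ ≤ W) (h₂ : W₂ ≤ W)
    {y₁ : (quotientFunctor ρ hρ).obj W₁} {y₂ : (quotientFunctor ρ hρ).obj W₂}
    (h : (quotientFunctor ρ hρ).map (homOfLE h₁) y₁ =
      (quotientFunctor ρ hρ).map (homOfLE h₂) y₂) :
    ∃ (W₀ : InvariantAffineOpen ρ) (k₁ : W₀ ⟶ W₁) (k₂ : W₀ ⟶ W₂)
      (y : (quotientFunctor ρ hρ).obj W₀),
      (quotientFunctor ρ hρ).map k₁ y = y₁ ∧ (quotientFunctor ρ hρ).map k₂ y = y₂ := by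
  obtain ⟨z₁, rfl⟩ := quot_surjective hρ y₁
  obtain ⟨z₂, rfl⟩ := quot_surjective hρ y₂
  rw [map_quot_apply, map_quot_apply] at h
  obtain ⟨g, hg⟩ := exists_emb_eq_of_quot_eq hρ h
  rw [emb_specMap_res, emb_specMap_res] at hg
  have hmem : W₂.emb z₂ ∈ W₁.opens := by
    rw [hg]
    exact W₁.le_preimage g (emb_mem z₁)
  obtain ⟨W₀, k₁, k₂, hmem₀⟩ := exists_le_le hρ hmem (emb_mem z₂)
  obtain ⟨z₀, hz₀⟩ := exists_emb_eq hmem₀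
  refine ⟨W₀, homOfLE k₁, homOfLE k₂, W₀.quot hρ z₀, ?_, ?_⟩
  · rw [map_quot_apply]
    refine (quot_eq_of_emb_eq hρ (g := g) ?_).symm
    rw [emb_specMap_res, hz₀, hg]
  · rw [map_quot_apply]
    congr 1
    apply emb_injective
    rw [emb_specMap_res, hz₀]

instance : (quotientFunctor ρ hρ ⋙ Scheme.forget).IsLocallyDirected where
  cond {_ _ _} f₁ f₂ _ _ h :=
    exists_quotientFunctor_map_eq hρ (leOfHom f₁) (leOfHom f₂) h

end InvariantAffineOpen

end LocalQuotients

section Basis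

variable {P Y : Scheme.{u}} (π : P ⟶ Y) {ι : Type*} {V : ι → Y.Opens}

lemma le_iSup_of_basis (hV : ∀ (U : Y.Opens), ∀ y ∈ U, ∃ i, y ∈ V i ∧ V i ≤ U) (U : Y.Opens) :
    U ≤ ⨆ i : {i // V i ≤ U}, V i := by
  intro y hy
  obtain ⟨i, hyi, hi⟩ := hV U y hy
  exact TopologicalSpace.Opens.mem_iSup.2 ⟨⟨i, hi⟩, hyi⟩

lemma preimage_le_iSup_of_basis (hV : ∀ (U : Y.Opens), ∀ y ∈ U, ∃ i, y ∈ V i ∧ V i ≤ U)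
    (U : Y.Opens) : π ⁻¹ᵁ U ≤ ⨆ i : {i // V i ≤ U}, π ⁻¹ᵁ V i := by
  rw [← Scheme.Hom.preimage_iSup]
  exact π.preimage_mono (le_iSup_of_basis hV U)

lemma app_map_apply {U U' : Y.Opens} (h : U' ≤ U) (t : Γ(Y, U)) :
    π.app U' (Y.presheaf.map (homOfLE h).op t) =
      P.presheaf.map (homOfLE (π.preimage_mono h)).op (π.app U t) :=
  congr($(π.naturality (homOfLE h).op) t)

lemma app_injective_of_basis (hV : ∀ (U : Y.Opens), ∀ y ∈ U, ∃ i, y ∈ V i ∧ V i ≤ U)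
    (hinj : ∀ i, Function.Injective (π.app (V i))) (U : Y.Opens) :
    Function.Injective (π.app U) := by
  intro s t hst
  refine TopCat.Sheaf.eq_of_locally_eq' Y.sheaf (fun i : {i // V i ≤ U} => V i) U
    (fun i => homOfLE i.2) (le_iSup_of_basis hV U) s t fun i => hinj i ?_
  exact (app_map_apply π i.2 s).trans ((congrArg _ hst).trans (app_map_apply π i.2 t).symm)

lemma isCompatible_of_app_eq_map (hinj : ∀ U, Function.Injective (π.app U)) {U : Y.Opens}
    (hVU : ∀ i, V i ≤ U) {s : Γ(P, π ⁻¹ᵁ U)} {t : ∀ i, Γ(Y, V i)}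
    (ht : ∀ i, π.app (V i) (t i) = P.presheaf.map (homOfLE (π.preimage_mono (hVU i))).op s) :
    TopCat.Presheaf.IsCompatible Y.presheaf V t := by
  have hres (k : ι) {O : Y.Opens} (hO : O ≤ V k) :
      π.app O (Y.presheaf.map (homOfLE hO).op (t k)) =
        P.presheaf.map (homOfLE (π.preimage_mono (hO.trans (hVU k)))).op s := by
    rw [app_map_apply, ht, ← CommRingCat.comp_apply, ← Functor.map_comp]
    rfl
  exact fun i j => hinj _ ((hres i inf_le_left).trans (hres j inf_le_right).symm)

lemma exists_app_eq_of_basis (hV : ∀ (U : Y.Opens), ∀ y ∈ U, ∃ i, y ∈ V i ∧ V i ≤ U)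
    (hinj : ∀ i, Function.Injective (π.app (V i))) (U : Y.Opens) (s : Γ(P, π ⁻¹ᵁ U))
    (hs : ∀ i (h : V i ≤ U), ∃ t,
      π.app (V i) t = P.presheaf.map (homOfLE (π.preimage_mono h)).op s) :
    ∃ t, π.app U t = s := by
  choose t ht using hs
  obtain ⟨(r : Γ(Y, U)), hr, -⟩ := TopCat.Sheaf.existsUnique_gluing' Y.sheaf
    (fun i : {i // V i ≤ U} => V i) U (fun i => homOfLE i.2) (le_iSup_of_basis hV U)
    (fun i => t i i.2) (isCompatible_of_app_eq_map π (app_injective_of_basis π hV hinj)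
      (fun i => i.2) fun i => ht i i.2)
  refine ⟨r, TopCat.Sheaf.eq_of_locally_eq' P.sheaf (fun i : {i // V i ≤ U} => π ⁻¹ᵁ V i)
    (π ⁻¹ᵁ U) (fun i => homOfLE (π.preimage_mono i.2)) (preimage_le_iSup_of_basis π hV U) _ s
    fun i => ?_⟩
  exact (app_map_apply π i.2 r).symm.trans ((congrArg _ (hr i)).trans (ht i i.2))

variable {π} {G : Type*} [Group G] {ρ : G → (P ⟶ P)}

lemma isRingOfInvariants_app_of_basis (hρ : IsAction ρ) (hπ : ∀ g, ρ g ≫ π = π)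
    (hV : ∀ (U : Y.Opens), ∀ y ∈ U, ∃ i, y ∈ V i ∧ V i ≤ U)
    (h : ∀ i, IsRingOfInvariants (sectionAction hρ (π ⁻¹ᵁ V i)
      fun g => preimage_le_of_comp_eq (hπ g) (V i)) (π.app (V i)).hom) (U : Y.Opens) :
    IsRingOfInvariants (sectionAction hρ (π ⁻¹ᵁ U) fun g => preimage_le_of_comp_eq (hπ g) U)
      (π.app U).hom where
  injective := app_injective_of_basis π hV (fun i => (h i).injective) U
  map_apply g b := by
    rw [← Scheme.Hom.appLE_eq_app]
    exact sectionAction_appLE hρ hπ _ _ g b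
  exists_eq s hs := exists_app_eq_of_basis π hV (fun i => (h i).injective) U s fun i hi => by
    refine (h i).exists_eq _ fun g => ?_
    have hres := RingHom.congr_fun (map_comp_sectionAction hρ (π.preimage_mono hi)
      (fun g => preimage_le_of_comp_eq (hπ g) (V i))
      (fun g => preimage_le_of_comp_eq (hπ g) U) g) s
    exact hres.symm.trans (congrArg _ (hs g))

end Basis

section Gluing

lemma exists_iso_appLE_eq {P Y : Scheme.{u}} {R : CommRingCat.{u}} {π : P ⟶ Y} {j : Spec R ⟶ Y}
    [IsOpenImmersion j] {U : P.Opens} (hU : IsAffineOpen U) {φ : R ⟶ Γ(P, U)}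
    (hφ : hU.fromSpec ≫ π = Spec.map φ ≫ j) (h : U ≤ π ⁻¹ᵁ j.opensRange) :
    ∃ e : Γ(Y, j.opensRange) ≅ R, π.appLE j.opensRange U h = e.hom ≫ φ := by
  have hV : IsAffineOpen j.opensRange := isAffineOpen_opensRange j
  let θ := IsOpenImmersion.isoOfRangeEq j hV.fromSpec (by rw [hV.range_fromSpec]; rfl)
  have hθ : Spec.map (Scheme.Spec.preimageIso θ).unop.hom = θ.hom :=
    Scheme.Spec.map_preimage θ.hom
  refine ⟨(Scheme.Spec.preimageIso θ).unop, specMap_fromSpec_injective hV ?_⟩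
  rw [hV.SpecMap_appLE_fromSpec π hU h, Spec.map_comp, Category.assoc, hθ,
    IsOpenImmersion.isoOfRangeEq_hom_fac, hφ]

variable {P : Scheme.{u}} {G : Type*} {ρ : G → (P ⟶ P)}

variable (ρ) in
/-- The scheme `P` is covered by affine open subsets that are stable under the action `ρ`. This is
the condition under which the quotient of `P` by a finite group exists. -/
def HasInvariantAffineCover : Prop := ∀ x : P, ∃ W : InvariantAffineOpen ρ, x ∈ W.opens

namespace InvariantAffineOpen

lemma hom_ext_emb (hcov : HasInvariantAffineCover ρ) {Y : Scheme.{u}} {f f' : P ⟶ Y}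
    (h : ∀ W : InvariantAffineOpen ρ, W.emb ≫ f = W.emb ≫ f') : f = f' := by
  refine Scheme.hom_ext_of_forall _ _ fun x => ?_
  obtain ⟨W, hW⟩ := hcov x
  refine ⟨W.opens, hW, ?_⟩
  rw [← W.isAffineOpen.toSpecΓ_fromSpec, Category.assoc, Category.assoc]
  exact congrArg _ (h W)

/-- The cover of `P` by all its invariant affine open subsets. -/
noncomputable def openCover (hcov : HasInvariantAffineCover ρ) : P.OpenCover where
  I₀ := InvariantAffineOpen ρ
  X W := Spec Γ(P, W.opens)
  f W := W.emb
  mem₀ := by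
    rw [Scheme.presieve₀_mem_precoverage_iff]
    refine ⟨fun x => ?_, inferInstance⟩
    obtain ⟨W, hW⟩ := hcov x
    exact ⟨W, exists_emb_eq hW⟩

section InvariantMorphism

variable {S : Scheme.{u}} {p : P ⟶ S}

lemma le_preimage_top (W : InvariantAffineOpen ρ) : W.opens ≤ p ⁻¹ᵁ ⊤ := le_top

variable [Group G] (hρ : IsAction ρ)

/-- The map `Γ(S, ⊤) ⟶ Γ(P, W)ᴳ` induced by an invariant morphism `P ⟶ S`. -/
def toInvRing (hp : ∀ g, ρ g ≫ p = p) (W : InvariantAffineOpen ρ) :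
    Γ(S, ⊤) ⟶ CommRingCat.of (W.invRing hρ) :=
  CommRingCat.ofHom ((p.appLE ⊤ W.opens (le_preimage_top W)).hom.codRestrict _ fun b g =>
    sectionAction_appLE hρ hp W.le_preimage (le_preimage_top W) g b)

lemma toInvRing_incl (hp : ∀ g, ρ g ≫ p = p) (W : InvariantAffineOpen ρ) :
    toInvRing hρ hp W ≫ W.incl hρ = p.appLE ⊤ W.opens (le_preimage_top W) := rfl

lemma toInvRing_invRes (hp : ∀ g, ρ g ≫ p = p) {W W' : InvariantAffineOpen ρ} (h : W ≤ W') :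
    toInvRing hρ hp W' ≫ invRes hρ h = toInvRing hρ hp W := by
  rw [← cancel_mono (W.incl hρ), Category.assoc, invRes_incl, ← Category.assoc, toInvRing_incl,
    toInvRing_incl, res, Scheme.Hom.appLE_map]

end InvariantMorphism

variable [Group G] [Finite G] (hρ : IsAction ρ)

section Glue

variable {Y : Scheme.{u}} {f : ∀ W : InvariantAffineOpen ρ, Spec Γ(P, W.opens) ⟶ Y}

include hρ

lemma fst_comp_eq_snd_comp (hf : ∀ {W W'} (h : W ≤ W'), Spec.map (res h) ≫ f W' = f W)
    (W W' : InvariantAffineOpen ρ) :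
    pullback.fst W.emb W'.emb ≫ f W = pullback.snd W.emb W'.emb ≫ f W' := by
  refine Scheme.hom_ext_of_forall _ _ fun x => ?_
  have hx : W.emb (pullback.fst W.emb W'.emb x) = W'.emb (pullback.snd W.emb W'.emb x) := by
    rw [← Scheme.Hom.comp_apply, ← Scheme.Hom.comp_apply, pullback.condition]
  obtain ⟨W₀, h, h', hx₀⟩ := exists_le_le hρ (W := W) (W' := W') (emb_mem _)
    (hx ▸ emb_mem (pullback.snd W.emb W'.emb x))
  obtain ⟨z, hz⟩ := exists_emb_eq hx₀
  let α : Spec Γ(P, W₀.opens) ⟶ pullback W.emb W'.emb :=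
    pullback.lift (Spec.map (res h)) (Spec.map (res h')) (by simp only [specMap_res_emb])
  have hα : α ≫ pullback.fst W.emb W'.emb ≫ W.emb = W₀.emb := by
    rw [← Category.assoc, pullback.lift_fst, specMap_res_emb]
  have hopen : IsOpenImmersion α := by
    have : IsOpenImmersion (α ≫ pullback.fst W.emb W'.emb ≫ W.emb) := by
      rw [hα]
      infer_instance
    exact IsOpenImmersion.of_comp α (pullback.fst W.emb W'.emb ≫ W.emb)
  refine ⟨α.opensRange, ⟨z, ?_⟩, ?_⟩
  · apply (pullback.fst W.emb W'.emb ≫ W.emb).isOpenEmbedding.injective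
    rw [← Scheme.Hom.comp_apply, hα, hz, Scheme.Hom.comp_apply]
  · rw [← cancel_epi α.isoOpensRange.hom, Scheme.Hom.isoOpensRange_hom_ι_assoc,
      Scheme.Hom.isoOpensRange_hom_ι_assoc, ← Category.assoc, ← Category.assoc,
      pullback.lift_fst, pullback.lift_snd, hf, hf]

lemma exists_glue (hcov : HasInvariantAffineCover ρ)
    (hf : ∀ {W W'} (h : W ≤ W'), Spec.map (res h) ≫ f W' = f W) :
    ∃ π : P ⟶ Y, ∀ W : InvariantAffineOpen ρ, W.emb ≫ π = f W :=
  ⟨(openCover hcov).glueMorphisms f (fst_comp_eq_snd_comp hρ hf),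
    (openCover hcov).ι_glueMorphisms f (fst_comp_eq_snd_comp hρ hf)⟩

end Glue

/-- The scheme glued from the affine quotients `Spec Γ(P, W)ᴳ`. -/
noncomputable abbrev glued : Scheme.{u} := colimit (quotientFunctor ρ hρ)

/-- The open immersion of `Spec Γ(P, W)ᴳ` into the glued quotient. -/
noncomputable abbrev gluedι (W : InvariantAffineOpen ρ) :
    (quotientFunctor ρ hρ).obj W ⟶ glued hρ :=
  colimit.ι (quotientFunctor ρ hρ) W

instance (W : InvariantAffineOpen ρ) : IsOpenImmersion (gluedι hρ W) :=
  inferInstanceAs (IsOpenImmersion (colimit.ι (quotientFunctor ρ hρ) W))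

instance (W : InvariantAffineOpen ρ) : IsAffine ((quotientFunctor ρ hρ).obj W) :=
  inferInstanceAs (IsAffine (Spec _))

variable {hρ} in
/-- The morphism `π` restricts to the affine quotient map `W ⟶ Spec Γ(P, W)ᴳ` on every invariant
affine open subset `W`. -/
abbrev IsGluedQuotient (π : P ⟶ glued hρ) : Prop :=
  ∀ W : InvariantAffineOpen ρ, W.emb ≫ π = W.quot hρ ≫ gluedι hρ W

lemma exists_isGluedQuotient (hcov : HasInvariantAffineCover ρ) :
    ∃ π : P ⟶ glued hρ, IsGluedQuotient π := by
  refine exists_glue hρ hcov fun {W W'} h => ?_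
  rw [← Category.assoc, specMap_res_quot, Category.assoc, colimit.w]

variable {hρ} {π : P ⟶ glued hρ} {W : InvariantAffineOpen ρ}

lemma apply_emb (hπ : IsGluedQuotient π) (z : Spec Γ(P, W.opens)) :
    π (W.emb z) = gluedι hρ W (W.quot hρ z) := by
  rw [← Scheme.Hom.comp_apply, hπ, Scheme.Hom.comp_apply]

lemma preimage_opensRange (hπ : IsGluedQuotient π) (hcov : HasInvariantAffineCover ρ)
    (W : InvariantAffineOpen ρ) : π ⁻¹ᵁ (gluedι hρ W).opensRange = W.opens := by
  refine le_antisymm ?_ fun x hx => ?_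
  · rintro x ⟨y, hy⟩
    obtain ⟨W', hW'⟩ := hcov x
    obtain ⟨z', rfl⟩ := exists_emb_eq hW'
    rw [apply_emb hπ] at hy
    obtain ⟨W₀, f, f', y₀, h, h'⟩ :=
      (Scheme.IsLocallyDirected.ι_eq_ι_iff (quotientFunctor ρ hρ)).1 hy
    obtain ⟨z₀, rfl⟩ := quot_surjective hρ y₀
    obtain ⟨g, hg⟩ := exists_emb_eq_of_quot_eq hρ
      ((map_quot_apply hρ (leOfHom f') z₀).symm.trans h')
    rw [emb_specMap_res] at hg
    rw [hg]
    exact leOfHom f (W₀.le_preimage g (emb_mem z₀))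
  · obtain ⟨z, rfl⟩ := exists_emb_eq hx
    exact ⟨W.quot hρ z, (apply_emb hπ z).symm⟩

lemma act_comp (hπ : IsGluedQuotient π) (hcov : HasInvariantAffineCover ρ) (g : G) :
    ρ g ≫ π = π := by
  refine hom_ext_emb hcov fun W => ?_
  rw [← Category.assoc, ← specMap_act_emb, Category.assoc, hπ, ← Category.assoc,
    specMap_act_quot]

lemma exists_mem_opensRange_le (hπ : IsGluedQuotient π) (hcov : HasInvariantAffineCover ρ)
    (U : (glued hρ).Opens) (y : glued hρ) (hy : y ∈ U) :
    ∃ W : InvariantAffineOpen ρ,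
      y ∈ (gluedι hρ W).opensRange ∧ (gluedι hρ W).opensRange ≤ U := by
  obtain ⟨W, y₀, rfl⟩ := Scheme.IsLocallyDirected.ι_jointly_surjective (quotientFunctor ρ hρ) y
  obtain ⟨z, rfl⟩ := quot_surjective hρ y₀
  have hz : π (W.emb z) = colimit.ι (quotientFunctor ρ hρ) W (W.quot hρ z) := apply_emb hπ z
  rw [← hz] at hy ⊢
  obtain ⟨f, hzf, hf⟩ := exists_mem_basicOpen_le hρ
    (fun g => preimage_le_of_comp_eq (act_comp hπ hcov g) U) (emb_mem z) hy
  refine ⟨W.basicOpen hρ f, ?_, ?_⟩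
  · rwa [← preimage_opensRange hπ hcov] at hzf
  · rintro _ ⟨y₁, rfl⟩
    obtain ⟨z₁, rfl⟩ := quot_surjective hρ y₁
    rw [← apply_emb hπ]
    exact hf (emb_mem z₁)

lemma isRingOfInvariants_appLE (hπ : IsGluedQuotient π) {O : P.Opens} (hO : O = W.opens)
    (hinv : ∀ g, O ≤ ρ g ⁻¹ᵁ O) (h : O ≤ π ⁻¹ᵁ (gluedι hρ W).opensRange) :
    IsRingOfInvariants (sectionAction hρ O hinv)
      (π.appLE (gluedι hρ W).opensRange O h).hom := by
  subst hO
  let R := CommRingCat.of (W.invRing hρ)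
  have : IsOpenImmersion (X := Spec R) (gluedι hρ W) :=
    inferInstanceAs (IsOpenImmersion (gluedι hρ W))
  obtain ⟨e, he⟩ : ∃ e : Γ(glued hρ, (gluedι hρ W).opensRange) ≅ R,
      π.appLE (gluedι hρ W).opensRange W.opens h = e.hom ≫ W.incl hρ :=
    exists_iso_appLE_eq W.isAffineOpen (hπ W) h
  rw [he]
  have hsub := W.isRingOfInvariants_subtype hρ
  refine ⟨hsub.injective.comp (ConcreteCategory.bijective_of_isIso e.hom).1,
    fun g b => hsub.map_apply g (e.hom b), fun a ha => ?_⟩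
  obtain ⟨b, rfl⟩ := hsub.exists_eq a ha
  obtain ⟨t, rfl⟩ := (ConcreteCategory.bijective_of_isIso e.hom).2 b
  exact ⟨t, rfl⟩

lemma isRingOfInvariants_app (hπ : IsGluedQuotient π) (hcov : HasInvariantAffineCover ρ)
    (U : (glued hρ).Opens) :
    IsRingOfInvariants (sectionAction hρ (π ⁻¹ᵁ U)
      fun g => preimage_le_of_comp_eq (act_comp hπ hcov g) U) (π.app U).hom := by
  refine isRingOfInvariants_app_of_basis hρ (act_comp hπ hcov)
    (exists_mem_opensRange_le hπ hcov) (fun W => ?_) U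
  rw [← Scheme.Hom.appLE_eq_app]
  exact isRingOfInvariants_appLE hπ (preimage_opensRange hπ hcov W) _ _

lemma isAffineHom_of_isGluedQuotient (hπ : IsGluedQuotient π)
    (hcov : HasInvariantAffineCover ρ) : IsAffineHom π := by
  refine isAffineHom_of_forall_exists_isAffineOpen π fun y => ?_
  obtain ⟨W, hy, -⟩ := exists_mem_opensRange_le hπ hcov ⊤ y trivial
  refine ⟨_, hy, isAffineOpen_opensRange (gluedι hρ W), ?_⟩
  rw [preimage_opensRange hπ hcov]
  exact W.isAffineOpen

lemma exists_comp_eq_of_isGluedQuotient {S : Scheme.{u}} [IsAffine S] {p : P ⟶ S}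
    (hπ : IsGluedQuotient π) (hcov : HasInvariantAffineCover ρ) (hp : ∀ g, ρ g ≫ p = p) :
    ∃ c : glued hρ ⟶ S, π ≫ c = p := by
  have hS := isAffineOpen_top S
  let t : Cocone (quotientFunctor ρ hρ) :=
    { pt := S
      ι.app W := Spec.map (toInvRing hρ hp W) ≫ hS.fromSpec
      ι.naturality W W' f := by
        change Spec.map (invRes hρ (leOfHom f)) ≫ Spec.map (toInvRing hρ hp W') ≫ hS.fromSpec =
          (Spec.map (toInvRing hρ hp W) ≫ hS.fromSpec) ≫ 𝟙 S
        rw [← Category.assoc, ← Spec.map_comp, toInvRing_invRes, Category.comp_id] }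
  refine ⟨colimit.desc _ t, hom_ext_emb hcov fun W => ?_⟩
  rw [← Category.assoc, hπ, Category.assoc, colimit.ι_desc]
  change Spec.map (W.incl hρ) ≫ Spec.map (toInvRing hρ hp W) ≫ hS.fromSpec = W.emb ≫ p
  rw [← Category.assoc, ← Spec.map_comp, toInvRing_incl]
  exact hS.SpecMap_appLE_fromSpec p W.isAffineOpen (le_preimage_top W)

end InvariantAffineOpen

open InvariantAffineOpen in
theorem exists_isQuotient {S : Scheme.{u}} [IsAffine S] [Group G] [Finite G] {P : Over S}
    {act : G → (P ⟶ P)} (hact : IsAction fun g => (act g).left)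
    (hcov : HasInvariantAffineCover fun g => (act g).left) :
    ∃ (Y : Over S) (π : P ⟶ Y), IsQuotient act π := by
  obtain ⟨π, hπ⟩ := exists_isGluedQuotient hact hcov
  obtain ⟨c, hc⟩ := exists_comp_eq_of_isGluedQuotient hπ hcov fun g => Over.w (act g)
  have hinv := isRingOfInvariants_app hπ hcov
  exact ⟨Over.mk c, Over.homMk π hc,
    { invariant := fun g => Over.OverMorphism.ext (act_comp hπ hcov g)
      affine := isAffineHom_of_isGluedQuotient hπ hcov
      injective := fun U => (hinv U).injective
      exists_of_invariant := fun U s hs => (hinv U).exists_eq s fun g => hs g _ }⟩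

end Gluing

section AffineProducts

lemma eq_of_toSpecΓ_comp_eq {T Z : Scheme.{u}} [IsAffine Z] {f g : Spec Γ(T, ⊤) ⟶ Z}
    (h : T.toSpecΓ ≫ f = T.toSpecΓ ≫ g) : f = g := by
  have : IsIso T.toSpecΓ.appTop := by
    rw [Scheme.toSpecΓ_appTop]
    infer_instance
  apply ext_of_isAffine
  rw [← cancel_mono T.toSpecΓ.appTop, ← Scheme.Hom.comp_appTop, ← Scheme.Hom.comp_appTop, h]

lemma isAffine_of_toSpecΓ_comp_eq_id {T : Scheme.{u}} {r : Spec Γ(T, ⊤) ⟶ T}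
    (h : T.toSpecΓ ≫ r = 𝟙 T) : IsAffine T :=
  ⟨r, h, eq_of_toSpecΓ_comp_eq <| by
    rw [← Category.assoc, h, Category.id_comp, Category.comp_id]⟩

variable {S : Scheme.{u}}

/-- The affine scheme `Spec Γ(T, ⊤)` over the affine base `S` of `T`: the affinization of `T`. -/
noncomputable def affinization [IsAffine S] (T : Over S) : Over S :=
  Over.mk (Spec.map T.hom.appTop ≫ S.isoSpec.inv)

lemma toSpecΓ_comp_specMap_isoSpec_inv {T Z : Scheme.{u}} [IsAffine Z] (f : T ⟶ Z) :
    T.toSpecΓ ≫ Spec.map f.appTop ≫ Z.isoSpec.inv = f := by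
  rw [← Category.assoc, ← Scheme.toSpecΓ_naturality, Category.assoc,
    Scheme.toSpecΓ_isoSpec_inv, Category.comp_id]

/-- The canonical morphism `T ⟶ Spec Γ(T, ⊤)` over the affine base `S` of `T`. -/
noncomputable def toAffinization [IsAffine S] (T : Over S) : T ⟶ affinization T :=
  Over.homMk T.left.toSpecΓ (toSpecΓ_comp_specMap_isoSpec_inv T.hom)

variable {X : Over S} {n : ℕ}

lemma exists_toAffinization_comp_eq [IsAffine S] {T : Over S} {U : X.left.Opens}
    (hU : IsAffineOpen U) (f : T ⟶ X) (hf : ∀ x, f.left x ∈ U) :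
    ∃ f' : affinization T ⟶ X, toAffinization T ≫ f' = f ∧ ∀ x, f'.left x ∈ U := by
  have : IsAffine U := hU
  let h : T.left ⟶ U := IsOpenImmersion.lift U.ι f.left <| by
    rintro _ ⟨x, rfl⟩
    rw [Scheme.Opens.range_ι]
    exact hf x
  have hι : h ≫ U.ι = f.left := IsOpenImmersion.lift_fac _ _ _
  let h' : Spec Γ(T.left, ⊤) ⟶ X.left := (Spec.map h.appTop ≫ U.toScheme.isoSpec.inv) ≫ U.ι
  have hh' : T.left.toSpecΓ ≫ h' = f.left := by
    rw [← Category.assoc, toSpecΓ_comp_specMap_isoSpec_inv, hι]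
  have hover : h' ≫ X.hom = (affinization T).hom := by
    refine eq_of_toSpecΓ_comp_eq ?_
    rw [← Category.assoc, hh', Over.w]
    exact (toSpecΓ_comp_specMap_isoSpec_inv T.hom).symm
  exact ⟨Over.homMk h' hover, Over.OverMorphism.ext hh', fun x => Subtype.prop _⟩

variable (X n) in
/-- The open subset of the `n`-fold product consisting of the points all of whose coordinates lie
in `U`: the `n`-fold product of `U`. -/
noncomputable def powerOpen (U : X.left.Opens) : (power X n).left.Opens where
  carrier := ⋂ i : Fin n, (Pi.π (fun _ : Fin n => X) i).left ⁻¹ᵁ U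
  is_open' := isOpen_iInter_of_finite fun i =>
    ((Pi.π (fun _ : Fin n => X) i).left ⁻¹ᵁ U).isOpen

lemma mem_powerOpen {U : X.left.Opens} {x : (power X n).left} :
    x ∈ powerOpen X n U ↔ ∀ i, (Pi.π (fun _ : Fin n => X) i).left x ∈ U :=
  Set.mem_iInter

/-- The coordinates of `W := powerOpen X n U` extend to the affinization of `W`, which gives a
retraction of `W ⟶ Spec Γ(W, ⊤)`. -/
lemma isAffineOpen_powerOpen [IsAffine S] {U : X.left.Opens} (hU : IsAffineOpen U) :
    IsAffineOpen (powerOpen X n U) := by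
  let W := powerOpen X n U
  let T : Over S := Over.mk (W.ι ≫ (power X n).hom)
  let ι : T ⟶ power X n := Over.homMk W.ι
  have hι (i) (x : T.left) : (ι ≫ Pi.π (fun _ : Fin n => X) i).left x ∈ U :=
    mem_powerOpen.1 x.2 i
  choose q hq hqU using fun i => exists_toAffinization_comp_eq hU _ (hι i)
  have hlift : toAffinization T ≫ Pi.lift q = ι := by
    refine Pi.hom_ext _ _ fun i => ?_
    rw [Category.assoc, Pi.lift_π, hq]
  have hrange : Set.range (Pi.lift q).left ⊆ Set.range W.ι := by
    rintro _ ⟨x, rfl⟩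
    rw [Scheme.Opens.range_ι]
    refine mem_powerOpen.2 fun i => ?_
    rw [← Scheme.Hom.comp_apply, ← Over.comp_left, Pi.lift_π]
    exact hqU i x
  let r : Spec Γ(W, ⊤) ⟶ W := IsOpenImmersion.lift W.ι (Pi.lift q).left hrange
  have hr : r ≫ W.ι = (Pi.lift q).left := IsOpenImmersion.lift_fac _ _ _
  refine isAffine_of_toSpecΓ_comp_eq_id (r := r) ?_
  rw [← cancel_mono W.ι, Category.assoc, hr, Category.id_comp]
  exact congrArg (fun f => f.left) hlift

lemma powerOpen_le_preimage (U : X.left.Opens) (σ : Equiv.Perm (Fin n)) :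
    powerOpen X n U ≤ (permute X n σ).left ⁻¹ᵁ powerOpen X n U := by
  refine fun x hx => mem_powerOpen.2 fun i => ?_
  rw [← Scheme.Hom.comp_apply, ← Over.comp_left, permute, Pi.lift_π]
  exact mem_powerOpen.1 hx (σ i)

variable (n) in
theorem exists_isSymmetricProduct [IsAffine S] (hX : FiniteSetsInAffine X.left) :
    ∃ (Y : Over S) (π : power X n ⟶ Y), IsSymmetricProduct X n π := by
  refine exists_isQuotient (isAction_permute X n) fun x => ?_
  obtain ⟨U, hU, hx⟩ := hX (Set.range fun i => (Pi.π (fun _ : Fin n => X) i).left x)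
    (Set.finite_range _)
  exact ⟨⟨powerOpen X n U, isAffineOpen_powerOpen hU, powerOpen_le_preimage U⟩,
    mem_powerOpen.2 fun i => hx ⟨i, rfl⟩⟩

end AffineProducts

end SymZeta

theorem mainTheorem2_general (k : Type u) [Field k] [Finite k]
    (X : Over (Spec (CommRingCat.of k))) [LocallyOfFiniteType X.hom] [QuasiCompact X.hom] :
    (SymZeta.FiniteSetsInAffine X.left →
      ∀ n : ℕ, ∃ (Y : Over (Spec (CommRingCat.of k))) (π : SymZeta.power X n ⟶ Y),
        SymZeta.IsSymmetricProduct X n π) ∧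
    (∀ n : ℕ, 1 ≤ n → Finite (SymZeta.Points X (SymZeta.Ext k n))) ∧
    ∀ (Y : ℕ → Over (Spec (CommRingCat.of k))) (π : ∀ n, SymZeta.power X n ⟶ Y n),
      (∀ n, SymZeta.IsSymmetricProduct X n (π n)) →
        (∀ n, Finite (SymZeta.Points (Y n) k)) ∧
        PowerSeries.mk (fun n => (Nat.card (SymZeta.Points (Y n) k) : ℚ)) =
          SymZeta.hasseWeil X := by
  have hX (n : ℕ) : Finite (SymZeta.Points X (SymZeta.Ext k n)) := by
    have : Finite (SymZeta.Ext k n) := Module.finite_of_finite k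
    exact SymZeta.finite_points X _
  refine ⟨fun haff n => SymZeta.exists_isSymmetricProduct n haff, fun n _ => hX n,
    fun Y π hπ => ⟨fun n => ?_, ?_⟩⟩
  · exact SymZeta.finite_points_of_isSymmetricProduct (fun n _ => hX n) (hπ n)
  · exact SymZeta.mk_card_points_eq_hasseWeil (fun n _ => hX n) hπ

theorem mainTheorem2 (k : Type u) [Field k] [Finite k]
    (X : Over (Spec (CommRingCat.of k))) (hX : SymZeta.IsVariety X) :
    (SymZeta.FiniteSetsInAffine X.left →
      ∀ n : ℕ, ∃ (Y : Over (Spec (CommRingCat.of k))) (π : SymZeta.power X n ⟶ Y),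
        SymZeta.IsSymmetricProduct X n π) ∧
    (∀ n : ℕ, 1 ≤ n → Finite (SymZeta.Points X (SymZeta.Ext k n))) ∧
    ∀ (Y : ℕ → Over (Spec (CommRingCat.of k))) (π : ∀ n, SymZeta.power X n ⟶ Y n),
      (∀ n, SymZeta.IsSymmetricProduct X n (π n)) →
        (∀ n, Finite (SymZeta.Points (Y n) k)) ∧
        PowerSeries.mk (fun n => (Nat.card (SymZeta.Points (Y n) k) : ℚ)) =
          SymZeta.hasseWeil X :=
  have := hX.locallyOfFiniteType
  have := hX.quasiCompact
  mainTheorem2_general k X
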